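/- **Setting.** Let $k\ge 0$, $n\ge 1$ be integers, $T:\{0,1\}^k\to\{0,1\}$ a truth table and $\gamma,\beta\in\mathbf R$. A clause is a $k$-tuple $\sigma=((l_q,\nu_q))_{q<k}$ with $l_q\in\{0,\dots,n-1\}$, $\nu_q\in\{0,1\}$; a string $x\in\{0,1\}^n$ satisfies it ($x\vdash\sigma$) if $T((x_{l_q}\oplus\nu_q)_{q<k})=1$, and violates it ($x\not\vdash\sigma$) otherwise. A random clause has all $l_q$, $\nu_q$ independent and uniform; a random instance $\boldsymbol\sigma=(\sigma_0,\dots,\sigma_{m-1})$ with $m\ge 0$ clauses consists of $m$ independent random clauses. Let $C_{\boldsymbol\sigma}(x)=\sum_{j<m}\mathbf 1[x\not\vdash\sigma_j]$, let $H[\boldsymbol\sigma]$ be the operator on $(\mathbf C^2)^{\otimes n}$ that is diagonal in the computational basis with entries $C_{\boldsymbol\sigma}(x)$, let $H_B=\sum_j X_j$, and $$|\Psi(\gamma,\beta,\boldsymbol\sigma)\rangle=e^{-\frac{i\beta}2H_B}e^{-\frac{i\gamma}2H[\boldsymbol\sigma]}|+\rangle^{\otimes n}.$$ The success probability of $p=1$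 QAOA on $\boldsymbol\sigma$ is $$\sum_{x:\,C_{\boldsymbol\sigma}(x)=0}|\langle x|\Psi(\gamma,\beta,\boldsymbol\sigma)\rangle|^2=\langle\Psi(\gamma,\beta,\boldsymbol\sigma)|\mathbf 1[H[\boldsymbol\sigma]=0]|\Psi(\gamma,\beta,\boldsymbol\sigma)\rangle .$$ For a triplet $z=(z^{[1]},z^{[0]},z^{[-1]})$ of $n$-bit strings and $s\in\{0,1\}^3$ let $n_s=|\{j:(z^{[1]}_j,z^{[0]}_j,z^{[-1]}_j)=s\}|$ (configuration basis numbers), and $n'_{bc}=n_{0bc}+n_{1\bar b\bar c}$ for $b,c\in\{0,1\}$ (reduced configuration basis numbers). Let $\mathcal P'(n)$ be the set of quadruples $q=(q_{00},q_{01},q_{10},q_{11})$ of non-negative integers with sum $n$. **Assumption.** For every non-empty $A\subseteq\{1,0,-1\}$ there is a real polynomial in four variables whose value at the reduced configuration basis numbers of any triplet $z$ is the probability, over a random clause $\sigma$, that $z^{[t]}\not\vdash\sigma$ for all $t\in A$. A *single-clause polynomial* is a complex polynomial $P_{\rm single}$ in four variables such that, for every triplet $z$ of $n$-bit strings, $$P_{\rm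 single}(n'_{00},n'_{01},n'_{10},n'_{11})=\mathbf E_\sigma\Big[e^{\frac{i\gamma}2(\mathbf 1[z^{[1]}\not\vdash\sigma]-\mathbf 1[z^{[-1]}\not\vdash\sigma])}\big(1-\mathbf 1[z^{[0]}\not\vdash\sigma]\big)\Big]=\mathbf E_\sigma\Big[e^{-\frac{i\gamma}2(\mathbf 1[z^{[1]}\vdash\sigma]-\mathbf 1[z^{[-1]}\vdash\sigma])}\mathbf 1[z^{[0]}\vdash\sigma]\Big].$$ **Proposition.** Suppose that the assumption holds. Then the two expectations above agree for every triplet, a single-clause polynomial exists, and any two of them take the same values on $\mathcal P'(n)$. For any single-clause polynomial $P_{\rm single}$ and $$W_q=\frac{n!}{q_{00}!\,q_{01}!\,q_{10}!\,q_{11}!}\Big(\cos^2\tfrac\beta2\Big)^{q_{00}}\Big(\sin^2\tfrac\beta2\Big)^{q_{10}}\Big(\tfrac{i\sin\beta}2\Big)^{q_{11}}\Big(-\tfrac{i\sin\beta}2\Big)^{q_{01}},$$ the following hold. 1. For every fixed $m\ge0$, the success probability averaged over random instances with $m$ clauses equals $\sum_{q\in\mathcal P'(n)}W_q\,P_{\rm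 single}(q)^m$. 2. For every real $r>0$, if $m\sim\mathrm{Poisson}(rn)$, the success probability averaged over $m$ and over random instances with $m$ clauses (this average over $m$ converges) equals $\sum_{q\in\mathcal P'(n)}W_q\exp\big(rn(P_{\rm single}(q)-1)\big)$. Both sums have $|\mathcal P'(n)|=\binom{n+3}3\le 4n^3$ terms. 3. Both averages can be computed with $O(n^3)$ evaluations of $P_{\rm single}$ and $O(n^3)$ other operations, with absolute implied constants. Precisely: consider programs with natural-number counters (operations: set to $0$, copy, increment, decrement) and complex registers (operations: imaginary unit, copy, conversion of a counter, $+,-,\times,/$, $\exp$, powers with a counter as exponent, evaluation of $P_{\rm single}$ at four counters), built from these operations by sequential composition and by loops repeated as often as a counter says at entry; each operation costs one, and a loop costs one more at entry and per iteration. There are an integer $C$ and one such program that outputs the average of item 1 on input $(n,m,\beta)$, and an integer $C$ and one that outputs the average of item 2 on input $(n,\beta,r)$, for all $k,n,T,\gamma,\beta$ and $m$ (respectively $r$) as above, with at most $Cn^3$ evaluations of $P_{\rm single}$ and at most $Cn^3$ other operations. The second program performs no powers with a counter as exponent. -/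

import Mathlib

open MeasureTheory ProbabilityTheory
open scoped Matrix

namespace QAOA

noncomputable section

/-! ### Random constraint satisfaction problems -/

/-- A truth table on `k` bits (`true` is the bit `1`). -/
abbrev TruthTable (k : ℕ) : Type := (Fin k → Bool) → Bool

/-- An assignment of `n` Boolean variables, i.e. an `n`-bit string. -/
abbrev BitString (n : ℕ) : Type := Fin n → Bool

/-- A clause: an ordered `k`-tuple of pairs (variable index, negation bit). -/
abbrev Clause (k n : ℕ) : Type := Fin k → Fin n × Bool

/-- An instance with `m` clauses. -/
abbrev Instance (k n m : ℕ) : Type := Fin m → Clause k n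

/-- `x` satisfies the clause `s`: the truth table is true on the bits `x_l ⊕ ν`. -/
def Satisfies {k n : ℕ} (T : TruthTable k) (x : BitString n) (s : Clause k n) : Prop :=
  T (fun q => xor (x (s q).1) (s q).2) = true

/-- `x` violates the clause `s`: the truth table is false on the bits `x_l ⊕ ν`. -/
def Violates {k n : ℕ} (T : TruthTable k) (x : BitString n) (s : Clause k n) : Prop :=
  T (fun q => xor (x (s q).1) (s q).2) = false

instance {k n : ℕ} (T : TruthTable k) (x : BitString n) (s : Clause k n) :
    Decidable (Satisfies T x s) := by unfold Satisfies; infer_instance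

instance {k n : ℕ} (T : TruthTable k) (x : BitString n) (s : Clause k n) :
    Decidable (Violates T x s) := by unfold Violates; infer_instance

/-- The law of one random clause: all indices and all negation bits are independent and uniform. -/
def clauseMeasure (k n : ℕ) : Measure (Clause k n) :=
  Measure.pi fun _ : Fin k =>
    (uniformOn (Set.univ : Set (Fin n))).prod (uniformOn (Set.univ : Set Bool))

/-- The law of a random instance with `m` independent random clauses. -/
def instanceMeasure (k n m : ℕ) : Measure (Instance k n m) :=
  Measure.pi fun _ : Fin m => clauseMeasure k n

/-- The cost function: the number of clauses violated by `x`. -/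
def cost {k n m : ℕ} (T : TruthTable k) (σ : Instance k n m) (x : BitString n) : ℕ :=
  ∑ j : Fin m, if Violates T x (σ j) then 1 else 0

/-! ### One-layer QAOA -/

/-- Operators on `n` qubits, as matrices in the computational basis. -/
abbrev Operator (n : ℕ) : Type := Matrix (BitString n) (BitString n) ℂ

/-- The Pauli operator `X_j`: it flips bit `j` and leaves the other bits unchanged. -/
def pauliX {n : ℕ} (j : Fin n) : Operator n :=
  Matrix.of fun x y => if x j ≠ y j ∧ ∀ i, i ≠ j → x i = y i then 1 else 0

/-- The transverse field Hamiltonian `H_B = ∑_j X_j`. -/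
def mixerHamiltonian (n : ℕ) : Operator n := ∑ j : Fin n, pauliX j

/-- The Hamiltonian that is diagonal in the computational basis with entries the cost function. -/
def costHamiltonian {k n m : ℕ} (T : TruthTable k) (σ : Instance k n m) : Operator n :=
  Matrix.diagonal fun x => (cost T σ x : ℂ)

/-- The state `|+⟩^{⊗ n}`. -/
def plusState (n : ℕ) : BitString n → ℂ := fun _ => ∏ _j : Fin n, (1 / (Real.sqrt 2 : ℂ))

/-- The state `exp(-(iβ/2) H_B) exp(-(iγ/2) H_C) |+⟩^{⊗ n}`. -/
def qaoaState {k n m : ℕ} (T : TruthTable k) (γ β : ℝ) (σ : Instance k n m) : BitString n → ℂ :=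
  NormedSpace.exp (-(Complex.I * β / 2) • mixerHamiltonian n) *ᵥ
    (NormedSpace.exp (-(Complex.I * γ / 2) • costHamiltonian T σ) *ᵥ plusState n)

/-- The orthogonal projector `1[H = 0]` onto the bit strings violating no clause. -/
def solutionProjector {k n m : ℕ} (T : TruthTable k) (σ : Instance k n m) : Operator n :=
  Matrix.diagonal fun x => if cost T σ x = 0 then 1 else 0

/-- The success probability on one instance: the probability that a measurement of the QAOA state
in the computational basis yields a bit string that violates no clause. -/
def successProb {k n m : ℕ} (T : TruthTable k) (γ β : ℝ) (σ : Instance k n m) : ℝ :=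
  ∑ x : BitString n, if cost T σ x = 0 then ‖qaoaState T γ β σ x‖ ^ 2 else 0

/-- The success probability averaged over random instances with exactly `m` clauses. -/
def avgSuccessProb {k : ℕ} (T : TruthTable k) (n : ℕ) (γ β : ℝ) (m : ℕ) : ℝ :=
  ∫ σ, successProb T γ β σ ∂(instanceMeasure k n m)

/-- The success probability averaged over random instances with `Poisson(r n)` clauses. -/
def poissonAvgSuccessProb {k : ℕ} (T : TruthTable k) (n : ℕ) (γ β r : ℝ) : ℝ :=
  ∫ m, avgSuccessProb T n γ β m ∂(poissonMeasure (Real.toNNReal (r * n)))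

/-! ### Configuration basis numbers -/

/-- A triplet of `n`-bit strings `(z^[1], z^[0], z^[-1])`; the superscripts `[1], [0], [-1]` are the
indices `0, 1, 2`. -/
abbrev Triplet (n : ℕ) : Type := Fin 3 → BitString n

/-- The configuration basis number `n_s` of a triplet. -/
def configNumber {n : ℕ} (z : Triplet n) (s : Fin 3 → Bool) : ℕ :=
  (Finset.univ.filter fun j : Fin n => ∀ t, z t j = s t).card

/-- The reduced configuration basis number `n'_{bc} = n_{0bc} + n_{1 b̄ c̄}` of a triplet. -/
def reducedNumber {n : ℕ} (z : Triplet n) (bc : Bool × Bool) : ℕ :=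
  configNumber z ![false, bc.1, bc.2] + configNumber z ![true, !bc.1, !bc.2]

/-- The set of reduced configuration basis numbers of weight `n`: quadruples of natural numbers
summing to `n`. -/
def reducedConfigs (n : ℕ) : Finset (Bool × Bool → ℕ) :=
  Finset.piAntidiag (Finset.univ : Finset (Bool × Bool)) n

/-- The assumption on single clauses: the probabilities that a random clause is simultaneously
violated by one, two or all three of `z^[1], z^[0], z^[-1]` are polynomials in the reduced
configuration basis numbers of the triplet. -/
def ClauseViolationAssumption {k : ℕ} (T : TruthTable k) (n : ℕ) : Prop :=
  ∀ A : Finset (Fin 3), A.Nonempty →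
    ∃ Q : MvPolynomial (Bool × Bool) ℝ, ∀ z : Triplet n,
      (clauseMeasure k n).real {s | ∀ t ∈ A, Violates T (z t) s} =
        MvPolynomial.eval (fun bc => (reducedNumber z bc : ℝ)) Q

/-- The indicator `1[x violates s]`. -/
def violInd {k n : ℕ} (T : TruthTable k) (x : BitString n) (s : Clause k n) : ℂ :=
  if Violates T x s then 1 else 0

/-- The indicator `1[x satisfies s]`. -/
def satInd {k n : ℕ} (T : TruthTable k) (x : BitString n) (s : Clause k n) : ℂ :=
  if Satisfies T x s then 1 else 0

/-- The single-clause average, over a random clause `s`, of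
`exp((iγ/2) (1[z^[1] violates s] - 1[z^[-1] violates s])) (1 - 1[z^[0] violates s])`. -/
def singleClauseAvg {k n : ℕ} (T : TruthTable k) (γ : ℝ) (z : Triplet n) : ℂ :=
  ∫ s, Complex.exp (Complex.I * γ / 2 * (violInd T (z 0) s - violInd T (z 2) s)) *
    (1 - violInd T (z 1) s) ∂(clauseMeasure k n)

/-- The value of a 4-variate polynomial at a quadruple of natural numbers. -/
def polyValue (P : MvPolynomial (Bool × Bool) ℂ) (q : Bool × Bool → ℕ) : ℂ :=
  MvPolynomial.eval (fun bc => (q bc : ℂ)) P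

/-- `P` is a single-clause polynomial: its value at the reduced configuration basis numbers of any
triplet is the single-clause average of this triplet. -/
def IsSingleClausePoly {k : ℕ} (T : TruthTable k) (n : ℕ) (γ : ℝ)
    (P : MvPolynomial (Bool × Bool) ℂ) : Prop :=
  ∀ z : Triplet n, singleClauseAvg T γ z = polyValue P (reducedNumber z)

/-- The multinomial coefficient times the four mixer factors, at `q = (q_00, q_01, q_10, q_11)`. -/
def mixerWeight (n : ℕ) (β : ℝ) (q : Bool × Bool → ℕ) : ℂ :=
  ((n.factorial / ∏ bc, (q bc).factorial : ℕ) : ℂ) *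
    ((Real.cos (β / 2) : ℂ) ^ 2) ^ q (false, false) *
    ((Real.sin (β / 2) : ℂ) ^ 2) ^ q (true, false) *
    (Complex.I * (Real.sin β : ℂ) / 2) ^ q (true, true) *
    (-(Complex.I * (Real.sin β : ℂ) / 2)) ^ q (false, true)

/-! ### A register machine with operation counts

Programs work on counters (natural numbers) and scalars (complex numbers). One and the same program
is run on all inputs, and the numbers of operations that it performs are recorded. -/

/-- Memory and operation counts of the machine: `evals` counts the evaluations of the black-box
function, `powers` counts the powers with natural exponent, `ops` counts all other operations. -/
structure MachineState where
  counter : ℕ → ℕ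
  scalar : ℕ → ℂ
  evals : ℕ
  powers : ℕ
  ops : ℕ

/-- The elementary operations. -/
inductive Operation where
  /-- counter `i` becomes `0` -/
  | zero (i : ℕ)
  /-- counter `i` becomes counter `j` -/
  | copy (i j : ℕ)
  /-- counter `i` is increased by one -/
  | succ (i : ℕ)
  /-- counter `i` is decreased by one, unless it is `0` -/
  | pred (i : ℕ)
  /-- scalar `a` becomes the value of counter `i` -/
  | cast (a i : ℕ)
  /-- scalar `a` becomes the imaginary unit -/
  | imag (a : ℕ)
  /-- scalar `a` becomes scalar `b` -/
  | move (a b : ℕ)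
  /-- scalar `a` becomes the sum of scalars `b` and `c` -/
  | plus (a b c : ℕ)
  /-- scalar `a` becomes the difference of scalars `b` and `c` -/
  | minus (a b c : ℕ)
  /-- scalar `a` becomes the product of scalars `b` and `c` -/
  | times (a b c : ℕ)
  /-- scalar `a` becomes the quotient of scalars `b` and `c` -/
  | divide (a b c : ℕ)
  /-- scalar `a` becomes the exponential of scalar `b` -/
  | expo (a b : ℕ)
  /-- scalar `a` becomes scalar `b` raised to the power counter `i` -/
  | power (a b i : ℕ)
  /-- scalar `a` becomes the value of the black-box function at counters `i00, i01, i10, i11` -/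
  | query (a i00 i01 i10 i11 : ℕ)

/-- Programs: single operations, sequential composition, and loops whose number of iterations is the
value of a counter at the entry of the loop. -/
inductive Program where
  | op (o : Operation)
  | seq (p q : Program)
  | loop (i : ℕ) (body : Program)

namespace MachineState

/-- Count one ordinary operation. -/
def tick (s : MachineState) : MachineState := { s with ops := s.ops + 1 }

/-- Write to a counter. -/
def setCounter (s : MachineState) (i v : ℕ) : MachineState :=
  { s with counter := Function.update s.counter i v }

/-- Write to a scalar register. -/
def setScalar (s : MachineState) (a : ℕ) (v : ℂ) : MachineState :=
  { s with scalar := Function.update s.scalar a v }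

/-- The initial state with the given inputs in the first counters and the first scalar registers;
all other registers and all counts are `0`. -/
def init (ns : List ℕ) (cs : List ℂ) : MachineState where
  counter := fun i => ns.getD i 0
  scalar := fun a => cs.getD a 0
  evals := 0
  powers := 0
  ops := 0

end MachineState

/-- The quadruple `(q_00, q_01, q_10, q_11)`. -/
def quadruple (q00 q01 q10 q11 : ℕ) : Bool × Bool → ℕ
  | (false, false) => q00
  | (false, true) => q01
  | (true, false) => q10
  | (true, true) => q11

/-- The effect of one elementary operation, with black-box function `F`. -/
def Operation.exec (F : (Bool × Bool → ℕ) → ℂ) (o : Operation) (s : MachineState) : MachineState :=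
  match o with
  | .zero i => (s.setCounter i 0).tick
  | .copy i j => (s.setCounter i (s.counter j)).tick
  | .succ i => (s.setCounter i (s.counter i + 1)).tick
  | .pred i => (s.setCounter i (s.counter i - 1)).tick
  | .cast a i => (s.setScalar a (s.counter i)).tick
  | .imag a => (s.setScalar a Complex.I).tick
  | .move a b => (s.setScalar a (s.scalar b)).tick
  | .plus a b c => (s.setScalar a (s.scalar b + s.scalar c)).tick
  | .minus a b c => (s.setScalar a (s.scalar b - s.scalar c)).tick
  | .times a b c => (s.setScalar a (s.scalar b * s.scalar c)).tick
  | .divide a b c => (s.setScalar a (s.scalar b / s.scalar c)).tick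
  | .expo a b => (s.setScalar a (Complex.exp (s.scalar b))).tick
  | .power a b i =>
      { s.setScalar a (s.scalar b ^ s.counter i) with powers := s.powers + 1 }
  | .query a i00 i01 i10 i11 =>
      { s.setScalar a (F (quadruple (s.counter i00) (s.counter i01) (s.counter i10)
          (s.counter i11))) with evals := s.evals + 1 }

/-- The final state of a program. A loop is charged one operation at its entry and one more for each
iteration, besides the operations of its body. -/
def Program.run (F : (Bool × Bool → ℕ) → ℂ) : Program → MachineState → MachineState
  | .op o, s => o.exec F s
  | .seq p q, s => q.run F (p.run F s)
  | .loop i body, s => (fun u => (body.run F u).tick)^[s.counter i] s.tick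

end

end QAOA

open QAOA

open QAOA

/-! Expanding the squared modulus of a QAOA amplitude in the computational basis gives a double sum
over input strings. With the measured string these form a triplet, so the success probability is
`2⁻ⁿ` times a sum over triplets of a weight that is a product over bits times a factor that is a
product over clauses (`successProb_eq_sum_triplet`). Because the clauses are independent, averaging
replaces the clause product by the `m`-th power of the single-clause average.

The mixer weight of a bit is unchanged when all three bits of the triplet flip, so it depends only
on two xors. Encoding a triplet by its first string and a word in these four reduced letters makes
the summand independent of that string. This cancels `2⁻ⁿ`, and grouping words by letter counts
produces multinomial coefficients (`sum_triplet_eq_sum_reducedConfigs`). For a Poisson number of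
clauses each power is averaged by the exponential series.

The single-clause average is polynomial because the exponential of a multiple of an indicator is
affine in the indicator, so it is a linear combination of joint violation probabilities
(`clauseFactor_eq_sum`). Uniqueness on the summation set holds because every quadruple of weight `n`
comes from a triplet.

The algorithm is a triple loop. Each multinomial weight splits into three binomial weights
(`mixerWeight_quadruple`), and consecutive binomial weights differ by a cheap ratio, so a term costs
a bounded number of operations on average. Loop invariants give correctness and the counts together.
-/

namespace QAOA

/-! ### The mixer -/

/-- Flip bit `j`. -/
def flipBit {n : ℕ} (j : Fin n) (x : BitString n) : BitString n := Function.update x j (!x j)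

lemma pauliX_apply {n : ℕ} (j : Fin n) (x y : BitString n) :
    pauliX j x y = if y = flipBit j x then 1 else 0 := by
  unfold pauliX flipBit
  rw [Matrix.of_apply]
  congr 1
  rw [eq_iff_iff]
  constructor
  · rintro ⟨h1, h2⟩
    ext i
    by_cases hi : i = j
    · subst hi
      revert h1
      cases x i <;> cases y i <;> simp
    · simp [hi, h2 i hi]
  · rintro rfl
    refine ⟨by simp, fun i hi => by simp [hi]⟩

lemma pauliX_mul_apply {n : ℕ} (j : Fin n) (M : Operator n) (x y : BitString n) :
    (pauliX j * M) x y = M (flipBit j x) y := by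
  simp [Matrix.mul_apply, pauliX_apply]

lemma flipBit_flipBit {n : ℕ} (j : Fin n) (x : BitString n) : flipBit j (flipBit j x) = x := by
  simp [flipBit]

lemma pauliX_mul_self {n : ℕ} (j : Fin n) : pauliX j * pauliX j = 1 := by
  ext x y
  rw [pauliX_mul_apply, pauliX_apply, flipBit_flipBit, Matrix.one_apply]
  simp [eq_comm]

lemma pauliX_commute {n : ℕ} (i j : Fin n) : Commute (pauliX i) (pauliX j) := by
  by_cases hij : i = j
  · subst hij; exact Commute.refl _
  ext x y
  rw [pauliX_mul_apply, pauliX_mul_apply, pauliX_apply, pauliX_apply]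
  congr 2
  simp only [flipBit]
  rw [Function.update_of_ne (Ne.symm hij), Function.update_of_ne hij, Function.update_comm hij]

/-- The exponential of a multiple of an involution. -/
lemma exp_smul_of_mul_self_eq_one {m : Type*} [Fintype m] [DecidableEq m] {A : Matrix m m ℂ}
    (hA : A * A = 1) (z : ℂ) :
    NormedSpace.exp (z • A) = Complex.cosh z • 1 + Complex.sinh z • A := by
  have heven : ∀ k : ℕ, A ^ (2 * k) = 1 := fun k => by rw [pow_mul, pow_two, hA, one_pow]
  rw [NormedSpace.exp_eq_tsum ℂ]
  -- Even powers of `A` are `1` and odd powers are `A`, so the two halves of the series are those of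
  -- `cosh` and `sinh`.
  refine HasSum.tsum_eq (HasSum.even_add_odd ?_ ?_)
  · convert! (Complex.hasSum_cosh z).smul_const (1 : Matrix m m ℂ) using 2 with k
    rw [smul_pow, heven, smul_smul, div_eq_inv_mul]
  · convert! (Complex.hasSum_sinh z).smul_const A using 2 with k
    rw [smul_pow, pow_succ A, heven, one_mul, smul_smul, div_eq_inv_mul]

/-- The Pauli operators commute, so the exponential factors over qubits, each factor being `cosh z +
sinh z X_j`. Taking a subset `s` makes induction possible: qubits outside `s` contribute a Kronecker
delta. -/
lemma exp_smul_sum_pauliX_apply {n : ℕ} (z : ℂ) (s : Finset (Fin n)) (x y : BitString n) :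
    NormedSpace.exp (z • ∑ j ∈ s, pauliX j) x y =
      ∏ j, if j ∈ s then (if x j = y j then Complex.cosh z else Complex.sinh z)
        else (if x j = y j then 1 else 0) := by
  induction s using Finset.induction_on generalizing x with
  | empty =>
    simp only [Finset.sum_empty, smul_zero, NormedSpace.exp_zero, Matrix.one_apply,
      Finset.notMem_empty, if_false]
    rw [Finset.prod_ite_zero]
    simp [funext_iff]
  | insert a s ha ih =>
    rw [Finset.sum_insert ha, smul_add, Matrix.exp_add_of_commute,
      exp_smul_of_mul_self_eq_one (pauliX_mul_self a), add_mul, Matrix.add_apply,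
      Matrix.smul_mul, Matrix.smul_mul, one_mul, Matrix.smul_apply, Matrix.smul_apply,
      pauliX_mul_apply, ih, ih, ← Finset.mul_prod_erase _ _ (Finset.mem_univ a),
      ← Finset.mul_prod_erase _ _ (Finset.mem_univ a),
      ← Finset.mul_prod_erase _ _ (Finset.mem_univ a)]
    · have h1 : ∏ j ∈ Finset.univ.erase a,
          (if j ∈ s then (if flipBit a x j = y j then Complex.cosh z else Complex.sinh z)
          else (if flipBit a x j = y j then 1 else 0)) = ∏ j ∈ Finset.univ.erase a,
          (if j ∈ s then (if x j = y j then Complex.cosh z else Complex.sinh z)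
          else (if x j = y j then 1 else 0)) := by
        refine Finset.prod_congr rfl fun j hj => ?_
        have : flipBit a x j = x j := by simp [flipBit, Finset.ne_of_mem_erase hj]
        rw [this]
      have h2 : ∏ j ∈ Finset.univ.erase a,
          (if j ∈ insert a s then (if x j = y j then Complex.cosh z else Complex.sinh z)
          else (if x j = y j then 1 else 0)) = ∏ j ∈ Finset.univ.erase a,
          (if j ∈ s then (if x j = y j then Complex.cosh z else Complex.sinh z)
          else (if x j = y j then 1 else 0)) := by
        refine Finset.prod_congr rfl fun j hj => ?_
        simp [Finset.mem_insert, Finset.ne_of_mem_erase hj]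
      rw [h1, h2]
      have h3 : flipBit a x a = !x a := by simp [flipBit]
      rw [h3]
      cases x a <;> cases y a <;> simp [ha]
    · exact ((Commute.sum_right _ _ _ fun j _ => pauliX_commute a j).smul_left z).smul_right z

/-- The matrix elements of the one-qubit mixer, as a function of whether the two bits agree. -/
noncomputable def mixerEntry (β : ℝ) (a b : Bool) : ℂ :=
  if a = b then (Real.cos (β / 2) : ℂ) else -(Complex.I * Real.sin (β / 2))

lemma exp_mixer_apply {n : ℕ} (β : ℝ) (x y : BitString n) :
    NormedSpace.exp (-(Complex.I * β / 2) • mixerHamiltonian n) x y =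
      ∏ j, mixerEntry β (x j) (y j) := by
  unfold mixerHamiltonian
  rw [exp_smul_sum_pauliX_apply]
  refine Finset.prod_congr rfl fun j _ => ?_
  have h : -(Complex.I * β / 2) = -((β / 2 : ℝ) : ℂ) * Complex.I := by push_cast; ring
  simp only [Finset.mem_univ, if_true, mixerEntry]
  rw [h, Complex.cosh_mul_I, Complex.sinh_mul_I, Complex.cos_neg, Complex.sin_neg,
    Complex.ofReal_cos, Complex.ofReal_sin]
  congr 1; ring

/-! ### Amplitudes, and the success probability as a sum over triplets -/

lemma exp_costHamiltonian {k n m : ℕ} (T : TruthTable k) (γ : ℝ) (σ : Instance k n m) :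
    NormedSpace.exp (-(Complex.I * γ / 2) • costHamiltonian T σ) =
      Matrix.diagonal fun x => Complex.exp (-(Complex.I * γ / 2) * (cost T σ x : ℂ)) := by
  unfold costHamiltonian
  rw [← Matrix.diagonal_smul, Matrix.exp_diagonal]
  congr 1
  ext x
  rw [Pi.coe_exp, Complex.exp_eq_exp_ℂ]
  rfl

lemma qaoaState_apply {k n m : ℕ} (T : TruthTable k) (γ β : ℝ) (σ : Instance k n m)
    (x : BitString n) :
    qaoaState T γ β σ x = (1 / (Real.sqrt 2 : ℂ)) ^ n * ∑ y : BitString n,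
      (∏ j, mixerEntry β (x j) (y j)) *
        Complex.exp (-(Complex.I * γ / 2) * (cost T σ y : ℂ)) := by
  unfold qaoaState plusState
  rw [exp_costHamiltonian, Matrix.mulVec, dotProduct, Finset.mul_sum]
  refine Finset.sum_congr rfl fun y _ => ?_
  rw [exp_mixer_apply, Matrix.mulVec_diagonal]
  simp
  ring

lemma cost_cast {k n m : ℕ} (T : TruthTable k) (σ : Instance k n m) (x : BitString n) :
    (cost T σ x : ℂ) = ∑ j, violInd T x (σ j) := by
  unfold cost
  simp [violInd]

/-- Being a solution is a conjunction over clauses; the product form is what lets independence act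
later. -/
lemma cost_eq_zero_indicator {k n m : ℕ} (T : TruthTable k) (σ : Instance k n m)
    (x : BitString n) :
    (if cost T σ x = 0 then 1 else 0 : ℂ) = ∏ j, (1 - violInd T x (σ j)) := by
  have h : ∀ j, (1 - violInd T x (σ j)) = if ¬ Violates T x (σ j) then 1 else 0 := by
    intro j; unfold violInd; split_ifs <;> simp_all
  simp_rw [h]
  rw [Finset.prod_ite_zero]
  simp [cost]

/-- The one-qubit factor of a triplet of bits. -/
noncomputable def bitWeight (β : ℝ) (s : Fin 3 → Bool) : ℂ :=
  star (mixerEntry β (s 1) (s 0)) * mixerEntry β (s 1) (s 2)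

/-- The factor contributed by one clause. -/
noncomputable def clauseFactor {k n : ℕ} (T : TruthTable k) (γ : ℝ) (z : Triplet n)
    (s : Clause k n) : ℂ :=
  Complex.exp (Complex.I * γ / 2 * (violInd T (z 0) s - violInd T (z 2) s)) *
    (1 - violInd T (z 1) s)

lemma prod_clauseFactor {k n m : ℕ} (T : TruthTable k) (γ : ℝ) (z : Triplet n)
    (σ : Instance k n m) :
    ∏ j, clauseFactor T γ z (σ j) =
      star (Complex.exp (-(Complex.I * γ / 2) * (cost T σ (z 0) : ℂ))) *
        Complex.exp (-(Complex.I * γ / 2) * (cost T σ (z 2) : ℂ)) *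
        (if cost T σ (z 1) = 0 then 1 else 0) := by
  simp only [clauseFactor, Finset.prod_mul_distrib]
  rw [← cost_eq_zero_indicator, ← Complex.exp_sum, ← Finset.mul_sum, Finset.sum_sub_distrib,
    ← cost_cast, ← cost_cast]
  congr 1
  rw [Complex.star_def, ← Complex.exp_conj, ← Complex.exp_add]
  congr 1
  simp only [map_mul, map_neg, map_div₀, Complex.conj_I, Complex.conj_ofReal, Complex.conj_ofNat,
    Complex.conj_natCast]
  ring

/-- Triplets as triples of strings. -/
def tripletEquiv (n : ℕ) : BitString n × BitString n × BitString n ≃ Triplet n where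
  toFun p := ![p.1, p.2.1, p.2.2]
  invFun z := (z 0, z 1, z 2)
  left_inv p := rfl
  right_inv z := by ext t; fin_cases t <;> rfl

/-- In the triplet, index `1` is the measured string, index `0` the summation string of the
conjugated amplitude and index `2` that of the amplitude. The two normalisations of the plus state
combine to `2⁻ⁿ`. -/
lemma successProb_eq_sum_triplet {k n m : ℕ} (T : TruthTable k) (γ β : ℝ)
    (σ : Instance k n m) :
    (successProb T γ β σ : ℂ) = (1 / 2 : ℂ) ^ n * ∑ z : Triplet n,
      (∏ j, bitWeight β fun t => z t j) * ∏ j, clauseFactor T γ z (σ j) := by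
  have hsq : (1 / (Real.sqrt 2 : ℂ)) ^ n * (1 / (Real.sqrt 2 : ℂ)) ^ n = (1 / 2 : ℂ) ^ n := by
    rw [← mul_pow, div_mul_div_comm, ← Complex.ofReal_mul, Real.mul_self_sqrt (by norm_num)]
    norm_num
  rw [← (tripletEquiv n).sum_comp, Fintype.sum_prod_type]
  simp_rw [Fintype.sum_prod_type]
  rw [Finset.sum_comm, successProb, Complex.ofReal_sum, Finset.mul_sum]
  refine Finset.sum_congr rfl fun x _ => ?_
  have hprob : ((if cost T σ x = 0 then ‖qaoaState T γ β σ x‖ ^ 2 else 0 : ℝ) : ℂ) =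
      star (qaoaState T γ β σ x) * qaoaState T γ β σ x *
        (if cost T σ x = 0 then 1 else 0) := by
    split_ifs
    · rw [mul_one, Complex.star_def, Complex.conj_mul']; push_cast; rfl
    · simp
  have hreal : star ((1 / (Real.sqrt 2 : ℂ)) ^ n) = (1 / (Real.sqrt 2 : ℂ)) ^ n := by
    simp
  rw [hprob, qaoaState_apply, star_mul', hreal, mul_mul_mul_comm, hsq, star_sum,
    Finset.sum_mul_sum, mul_assoc, Finset.sum_mul]
  congr 1
  refine Finset.sum_congr rfl fun w _ => ?_
  rw [Finset.sum_mul]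
  refine Finset.sum_congr rfl fun y _ => ?_
  have h0 : tripletEquiv n (w, x, y) 0 = w := rfl
  have h1 : tripletEquiv n (w, x, y) 1 = x := rfl
  have h2 : tripletEquiv n (w, x, y) 2 = y := rfl
  rw [prod_clauseFactor]
  simp only [bitWeight, Finset.prod_mul_distrib, star_mul', star_prod, h0, h1, h2]
  ring

lemma successProb_eq_expectation {k n m : ℕ} (T : TruthTable k) (γ β : ℝ)
    (σ : Instance k n m) :
    (successProb T γ β σ : ℂ) =
      star (qaoaState T γ β σ) ⬝ᵥ (solutionProjector T σ *ᵥ qaoaState T γ β σ) := by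
  rw [successProb, Complex.ofReal_sum, dotProduct]
  refine Finset.sum_congr rfl fun x _ => ?_
  rw [solutionProjector, Matrix.mulVec_diagonal, Pi.star_apply, Complex.star_def]
  split_ifs
  · rw [one_mul, Complex.conj_mul']; push_cast; rfl
  · simp

/-! ### Sums over triplets as sums over reduced configuration basis numbers -/

lemma _root_.MvPolynomial.prod_X_pow_eq_monomial_univ {κ R : Type*} [Fintype κ] [CommSemiring R]
    (q : κ → ℕ) :
    ∏ i, (MvPolynomial.X i : MvPolynomial κ R) ^ q i =
      MvPolynomial.monomial (Finsupp.equivFunOnFinite.symm q) 1 := by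
  rw [MvPolynomial.monomial_eq, Finsupp.prod_fintype _ _ (by simp)]
  simp

/-- Summing over all words of length `n` a function of the letter counts. -/
lemma sum_words_eq_sum_piAntidiag {κ : Type*} [Fintype κ] [DecidableEq κ] (n : ℕ)
    (G : (κ → ℕ) → ℂ) :
    ∑ c : Fin n → κ, G (fun i => (Finset.univ.filter fun j => c j = i).card) =
      ∑ q ∈ Finset.piAntidiag Finset.univ n, (Nat.multinomial Finset.univ q : ℂ) * G q := by
  -- The linear functional sending the monomial with exponents `q` to `G q`. Applying it to the word
  -- expansion and to the multinomial expansion of `(∑ X_i)ⁿ` gives the two sides.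
  let L : MvPolynomial κ ℂ →ₗ[ℂ] ℂ :=
    (MvPolynomial.basisMonomials κ ℂ).constr ℂ fun q => G q
  have hL : ∀ q : κ → ℕ, L (∏ i, (MvPolynomial.X i : MvPolynomial κ ℂ) ^ q i) = G q := by
    intro q
    rw [MvPolynomial.prod_X_pow_eq_monomial_univ]
    have := (MvPolynomial.basisMonomials κ ℂ).constr_basis ℂ (fun q => G q)
      (Finsupp.equivFunOnFinite.symm q)
    rw [MvPolynomial.coe_basisMonomials] at this
    exact this
  have h1 := Fintype.sum_pow (fun i : κ => (MvPolynomial.X i : MvPolynomial κ ℂ)) n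
  rw [Finset.sum_pow_eq_sum_piAntidiag] at h1
  have h2 := congrArg L h1
  rw [map_sum, map_sum] at h2
  have h3 : ∀ c : Fin n → κ, ∏ j, (MvPolynomial.X (c j) : MvPolynomial κ ℂ) =
      ∏ i, MvPolynomial.X i ^ (Finset.univ.filter fun j => c j = i).card := by
    intro c
    rw [← Finset.prod_fiberwise Finset.univ c]
    refine Finset.prod_congr rfl fun i _ => ?_
    rw [← Finset.prod_const]
    exact Finset.prod_congr rfl fun j hj => by rw [(Finset.mem_filter.1 hj).2]
  simp_rw [h3, hL, ← nsmul_eq_mul, map_nsmul, hL] at h2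
  simp_rw [← nsmul_eq_mul]
  exact h2.symm

/-- The reduction of a configuration `s` by the first bit. -/
def reduceBits (s : Fin 3 → Bool) : Bool × Bool := (xor (s 0) (s 1), xor (s 0) (s 2))

lemma reducedNumber_eq_card {n : ℕ} (z : Triplet n) (bc : Bool × Bool) :
    reducedNumber z bc =
      (Finset.univ.filter fun j : Fin n => reduceBits (fun t => z t j) = bc).card := by
  obtain ⟨b, c⟩ := bc
  unfold reducedNumber configNumber
  rw [← Finset.card_union_of_disjoint]
  · congr 1
    ext j
    simp only [Finset.mem_union, Finset.mem_filter, Finset.mem_univ, true_and, reduceBits,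
      Fin.forall_fin_succ, Prod.mk.injEq]
    simp
    cases z 0 j <;> cases z 1 j <;> cases z 2 j <;> cases b <;> cases c <;> simp
  · rw [Finset.disjoint_left]
    intro j h1 h2
    simp only [Finset.mem_filter, Finset.mem_univ, true_and] at h1 h2
    simpa [h1 0] using h2 0

/-- Triplets as a string together with a word of reduced configurations. -/
def reducedTripletEquiv (n : ℕ) : BitString n × (Fin n → Bool × Bool) ≃ Triplet n where
  toFun p := ![p.1, fun j => xor (p.1 j) (p.2 j).1, fun j => xor (p.1 j) (p.2 j).2]
  invFun z := (z 0, fun j => reduceBits fun t => z t j)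
  left_inv p := by
    refine Prod.ext rfl (funext fun j => ?_)
    simp [reduceBits]
  right_inv z := by
    ext t j
    fin_cases t <;> simp [reduceBits]

lemma reduceBits_reducedTripletEquiv {n : ℕ} (x : BitString n) (c : Fin n → Bool × Bool)
    (j : Fin n) : reduceBits (fun t => reducedTripletEquiv n (x, c) t j) = c j :=
  congrFun (congrArg Prod.snd ((reducedTripletEquiv n).symm_apply_apply (x, c))) j

lemma reducedNumber_reducedTripletEquiv {n : ℕ} (x : BitString n) (c : Fin n → Bool × Bool) :
    reducedNumber (reducedTripletEquiv n (x, c)) =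
      fun i => (Finset.univ.filter fun j => c j = i).card := by
  ext i
  rw [reducedNumber_eq_card]
  simp_rw [reduceBits_reducedTripletEquiv]

lemma mem_reducedConfigs {n : ℕ} {q : Bool × Bool → ℕ} :
    q ∈ reducedConfigs n ↔ ∑ i, q i = n := by
  simp [reducedConfigs]

lemma exists_reducedNumber_eq {n : ℕ} {q : Bool × Bool → ℕ} (hq : q ∈ reducedConfigs n) :
    ∃ z : Triplet n, reducedNumber z = q := by
  rw [mem_reducedConfigs] at hq
  have hex : ∃ c : Fin n → Bool × Bool,
      (fun i => (Finset.univ.filter fun j => c j = i).card) = q := by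
    -- Apply the counting identity to the indicator of `q`: if no word had these letter counts, the
    -- positive multinomial coefficient would vanish.
    by_contra! hne
    have h := sum_words_eq_sum_piAntidiag n fun p : Bool × Bool → ℕ => if p = q then 1 else 0
    simp only [hne, if_false, Finset.sum_const_zero, mul_ite, mul_one, mul_zero,
      Finset.sum_ite_eq', Finset.mem_piAntidiag, hq, Finset.mem_univ, implies_true, and_self,
      if_true] at h
    exact (Nat.multinomial_pos Finset.univ q).ne' (by exact_mod_cast h.symm)
  obtain ⟨c, hc⟩ := hex
  exact ⟨reducedTripletEquiv n (fun _ => false, c), by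
    rw [reducedNumber_reducedTripletEquiv, hc]⟩

/-- In the coordinates of `reducedTripletEquiv` the summand ignores the first string, whose `2ⁿ`
values cancel the prefactor; the remaining sum over words depends only on letter counts. -/
lemma sum_triplet_eq_sum_reducedConfigs (n : ℕ) (f : Bool × Bool → ℂ)
    (g : (Bool × Bool → ℕ) → ℂ) :
    (1 / 2 : ℂ) ^ n * ∑ z : Triplet n,
      (∏ j, f (reduceBits fun t => z t j)) * g (reducedNumber z) =
    ∑ q ∈ reducedConfigs n,
      (Nat.multinomial Finset.univ q : ℂ) * (∏ i, f i ^ q i) * g q := by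
  rw [← (reducedTripletEquiv n).sum_comp, Fintype.sum_prod_type]
  have h : ∀ (x : BitString n) (c : Fin n → Bool × Bool),
      (∏ j, f (reduceBits fun t => reducedTripletEquiv n (x, c) t j)) *
        g (reducedNumber (reducedTripletEquiv n (x, c))) =
      (fun q : Bool × Bool → ℕ => (∏ i, f i ^ q i) * g q)
        (fun i => (Finset.univ.filter fun j => c j = i).card) := by
    intro x c
    simp_rw [reduceBits_reducedTripletEquiv, reducedNumber_reducedTripletEquiv]
    congr 1
    rw [← Finset.prod_fiberwise Finset.univ c]
    refine Finset.prod_congr rfl fun i _ => ?_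
    rw [← Finset.prod_const]
    exact Finset.prod_congr rfl fun j hj => by rw [(Finset.mem_filter.1 hj).2]
  rw [Finset.sum_congr rfl fun x _ => (Finset.sum_congr rfl fun c _ => h x c).trans
    (sum_words_eq_sum_piAntidiag n fun q => (∏ i, f i ^ q i) * g q)]
  rw [Finset.sum_const, Finset.card_univ, Fintype.card_fun, Fintype.card_bool, Fintype.card_fin,
    nsmul_eq_mul, ← mul_assoc, Nat.cast_pow, ← mul_pow]
  norm_num
  simp_rw [mul_assoc]
  rfl

/-- The four mixer factors. -/
noncomputable def mixerFactor (β : ℝ) : Bool × Bool → ℂ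
  | (false, false) => (Real.cos (β / 2) : ℂ) ^ 2
  | (true, false) => (Real.sin (β / 2) : ℂ) ^ 2
  | (true, true) => Complex.I * (Real.sin β : ℂ) / 2
  | (false, true) => -(Complex.I * (Real.sin β : ℂ) / 2)

lemma bitWeight_eq (β : ℝ) (s : Fin 3 → Bool) :
    bitWeight β s = mixerFactor β (reduceBits s) := by
  have hs : (Real.sin β : ℂ) = 2 * Real.sin (β / 2) * Real.cos (β / 2) := by
    rw [← Complex.ofReal_ofNat, ← Complex.ofReal_mul, ← Complex.ofReal_mul, ← Real.sin_two_mul]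
    congr 2; ring
  have hI := Complex.I_sq
  unfold bitWeight mixerEntry reduceBits
  cases s 0 <;> cases s 1 <;> cases s 2 <;>
    simp only [mixerFactor, hs, Bool.xor_false, Bool.xor_true,
      Bool.not_true, Bool.not_false, if_true, if_false, reduceCtorEq, Complex.star_def,
      Complex.conj_ofReal, map_neg, map_mul, Complex.conj_I] <;>
    -- The second alternative serves the letter `(true, false)`, where both mixer entries are
    -- off-diagonal and `I² = -1` is needed.
    first | ring1 | linear_combination (-(Real.sin (β / 2) : ℂ) ^ 2) * hI

lemma mixerWeight_eq {n : ℕ} (β : ℝ) {q : Bool × Bool → ℕ} (hq : q ∈ reducedConfigs n) :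
    mixerWeight n β q = (Nat.multinomial Finset.univ q : ℂ) * ∏ i, mixerFactor β i ^ q i := by
  rw [mem_reducedConfigs] at hq
  unfold mixerWeight Nat.multinomial
  rw [hq]
  simp only [Fintype.prod_prod_type, Fintype.prod_bool, mixerFactor]
  ring


/-! ### Averages over random clauses and instances -/

section

variable {k n : ℕ}

instance isProbabilityMeasure_clauseMeasure [NeZero n] :
    IsProbabilityMeasure (clauseMeasure k n) := by
  have h1 : IsProbabilityMeasure (uniformOn (Set.univ : Set (Fin n))) :=
    isProbabilityMeasure_uniformOn Set.finite_univ Set.univ_nonempty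
  have h2 : IsProbabilityMeasure (uniformOn (Set.univ : Set Bool)) :=
    isProbabilityMeasure_uniformOn Set.finite_univ Set.univ_nonempty
  unfold clauseMeasure
  infer_instance

instance isProbabilityMeasure_instanceMeasure [NeZero n] (m : ℕ) :
    IsProbabilityMeasure (instanceMeasure k n m) := by
  unfold instanceMeasure
  infer_instance

/-- The instance law is a product measure, so the integral of a product over clauses is a power of
one integral. Integrability is free because there are finitely many instances. -/
lemma avgSuccessProb_eq_sum_triplet [NeZero n] (T : TruthTable k) (γ β : ℝ) (m : ℕ) :
    (avgSuccessProb T n γ β m : ℂ) = (1 / 2 : ℂ) ^ n * ∑ z : Triplet n,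
      (∏ j, bitWeight β fun t => z t j) * singleClauseAvg T γ z ^ m := by
  unfold avgSuccessProb
  rw [← integral_complex_ofReal]
  simp_rw [successProb_eq_sum_triplet]
  rw [integral_const_mul, integral_finsetSum _ fun z _ => Integrable.of_finite]
  congr 1
  refine Finset.sum_congr rfl fun z _ => ?_
  rw [integral_const_mul]
  congr 1
  unfold instanceMeasure
  rw [integral_fintype_prod_eq_pow, Fintype.card_fin]
  rfl

lemma avgSuccessProb_eq_sum_reducedConfigs [NeZero n] {T : TruthTable k} {γ : ℝ} (β : ℝ)
    {P : MvPolynomial (Bool × Bool) ℂ} (hP : IsSingleClausePoly T n γ P) (m : ℕ) :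
    (avgSuccessProb T n γ β m : ℂ) =
      ∑ q ∈ reducedConfigs n, mixerWeight n β q * polyValue P q ^ m := by
  rw [avgSuccessProb_eq_sum_triplet]
  simp_rw [bitWeight_eq, hP _]
  rw [sum_triplet_eq_sum_reducedConfigs n (mixerFactor β) fun q => polyValue P q ^ m]
  exact Finset.sum_congr rfl fun q hq => by rw [mixerWeight_eq β hq]

/-! ### Single-clause polynomials -/

lemma polyValue_eq_of_isSingleClausePoly {T : TruthTable k} {γ : ℝ}
    {P P' : MvPolynomial (Bool × Bool) ℂ} (hP : IsSingleClausePoly T n γ P)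
    (hP' : IsSingleClausePoly T n γ P') {q : Bool × Bool → ℕ} (hq : q ∈ reducedConfigs n) :
    polyValue P q = polyValue P' q := by
  obtain ⟨z, rfl⟩ := exists_reducedNumber_eq hq
  rw [← hP z, ← hP' z]

lemma singleClauseAvg_eq_integral_satInd (T : TruthTable k) (γ : ℝ) (z : Triplet n) :
    singleClauseAvg T γ z =
      ∫ s, Complex.exp (-(Complex.I * γ / 2) * (satInd T (z 0) s - satInd T (z 2) s)) *
        satInd T (z 1) s ∂(clauseMeasure k n) := by
  have h : ∀ (x : BitString n) (s : Clause k n), violInd T x s = 1 - satInd T x s := by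
    intro x s
    unfold violInd satInd Violates Satisfies
    rcases Bool.eq_false_or_eq_true (T fun q => xor (x (s q).1) (s q).2) with h | h <;> simp [h]
  unfold singleClauseAvg
  simp_rw [h]
  congr 1
  ext s
  congr 1
  · congr 1; ring
  · ring

/-- The coefficients in the expansion of the clause factor in violation indicators. -/
noncomputable def clauseCoeff (γ : ℝ) : Fin 3 → ℂ :=
  ![Complex.exp (Complex.I * γ / 2) - 1, -1, Complex.exp (-(Complex.I * γ / 2)) - 1]

/-- For an indicator `v`, `exp (a v) = 1 + (exp a - 1) v`. So all three factors are affine in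
indicators, and expanding their product runs over subsets of the triplet. -/
lemma clauseFactor_eq_sum (T : TruthTable k) (γ : ℝ) (z : Triplet n) (s : Clause k n) :
    clauseFactor T γ z s = ∑ A : Finset (Fin 3),
      (∏ t ∈ A, clauseCoeff γ t) * if ∀ t ∈ A, Violates T (z t) s then 1 else 0 := by
  have h : clauseFactor T γ z s = ∏ t, (1 + clauseCoeff γ t * violInd T (z t) s) := by
    rw [Fin.prod_univ_three]
    unfold clauseFactor clauseCoeff violInd
    simp only [Matrix.cons_val]
    rw [mul_right_comm]
    congr 1
    · split_ifs
      · simp [← Complex.exp_add]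
      · simp
      · simp
      · simp
    · ring
  rw [h, Finset.prod_one_add, Finset.powerset_univ]
  refine Finset.sum_congr rfl fun A _ => ?_
  rw [Finset.prod_mul_distrib]
  simp only [violInd]
  rw [Finset.prod_ite_zero, Finset.prod_const_one]
  congr

lemma exists_isSingleClausePoly [NeZero n] {T : TruthTable k} (γ : ℝ)
    (h : ClauseViolationAssumption T n) : ∃ P, IsSingleClausePoly T n γ P := by
  have hall : ∀ A : Finset (Fin 3), ∃ Q : MvPolynomial (Bool × Bool) ℝ, ∀ z : Triplet n,
      (clauseMeasure k n).real {s | ∀ t ∈ A, Violates T (z t) s} =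
        MvPolynomial.eval (fun bc => (reducedNumber z bc : ℝ)) Q := by
    intro A
    -- The empty subset is outside the assumption, but its event is certain, so the constant `1`
    -- serves.
    rcases A.eq_empty_or_nonempty with rfl | hA
    · exact ⟨1, fun z => by simp⟩
    · exact h A hA
  choose Q hQ using hall
  refine ⟨∑ A : Finset (Fin 3), MvPolynomial.C (∏ t ∈ A, clauseCoeff γ t) *
    MvPolynomial.map Complex.ofRealHom (Q A), fun z => ?_⟩
  change ∫ s, clauseFactor T γ z s ∂(clauseMeasure k n) = _
  simp_rw [clauseFactor_eq_sum]
  rw [integral_finsetSum _ fun z _ => Integrable.of_finite, polyValue, map_sum]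
  refine Finset.sum_congr rfl fun A _ => ?_
  rw [integral_const_mul, map_mul, MvPolynomial.eval_C]
  congr 1
  have hv : MvPolynomial.eval (fun bc => (reducedNumber z bc : ℂ))
      (MvPolynomial.map Complex.ofRealHom (Q A)) =
      Complex.ofRealHom (MvPolynomial.eval (fun bc => (reducedNumber z bc : ℝ)) (Q A)) := by
    rw [MvPolynomial.map_eval]
    rfl
  rw [hv, ← hQ A z]
  have hint := integral_indicator_const (μ := clauseMeasure k n) (1 : ℂ)
    (s := {s | ∀ t ∈ A, Violates T (z t) s}) (Set.toFinite _).measurableSet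
  simp only [Set.indicator_apply, Set.mem_ofPred_eq] at hint
  rw [hint]
  simp

/-! ### A Poisson number of clauses -/

lemma integrable_pow_poissonMeasure (r : NNReal) (w : ℂ) :
    Integrable (fun m : ℕ => w ^ m) (poissonMeasure r) := by
  rw [integrable_poissonMeasure_iff]
  convert! (Real.summable_pow_div_factorial (r * ‖w‖)).mul_left (Real.exp (-r)) using 2 with m
  rw [norm_pow, mul_pow]
  ring

lemma integral_pow_poissonMeasure (r : NNReal) (w : ℂ) :
    ∫ m : ℕ, w ^ m ∂(poissonMeasure r) = Complex.exp (r * (w - 1)) := by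
  rw [integral_poissonMeasure]
  have h := ((NormedSpace.expSeries_div_hasSum_exp ((r : ℂ) * w)).mul_left
    (Complex.exp (-r))).tsum_eq
  rw [← Complex.exp_eq_exp_ℂ, ← Complex.exp_add] at h
  rw [show (r : ℂ) * (w - 1) = -r + r * w by ring, ← h]
  congr 1
  ext m
  rw [Complex.real_smul, mul_pow]
  push_cast
  ring

lemma integrable_avgSuccessProb_poissonMeasure [NeZero n] {T : TruthTable k} {γ : ℝ} (β : ℝ)
    {P : MvPolynomial (Bool × Bool) ℂ} (hP : IsSingleClausePoly T n γ P) (r : NNReal) :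
    Integrable (avgSuccessProb T n γ β) (poissonMeasure r) := by
  have h : Integrable (fun m => (avgSuccessProb T n γ β m : ℂ)) (poissonMeasure r) := by
    simp_rw [avgSuccessProb_eq_sum_reducedConfigs β hP]
    exact integrable_finsetSum _ fun q _ => (integrable_pow_poissonMeasure r _).const_mul _
  simpa using h.re

lemma poissonAvgSuccessProb_eq_sum_reducedConfigs [NeZero n] {T : TruthTable k} {γ : ℝ} (β : ℝ)
    {P : MvPolynomial (Bool × Bool) ℂ} (hP : IsSingleClausePoly T n γ P) {r : ℝ} (hr : 0 < r) :
    (poissonAvgSuccessProb T n γ β r : ℂ) =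
      ∑ q ∈ reducedConfigs n, mixerWeight n β q * Complex.exp (r * n * (polyValue P q - 1)) := by
  unfold poissonAvgSuccessProb
  rw [← integral_complex_ofReal]
  simp_rw [avgSuccessProb_eq_sum_reducedConfigs β hP]
  rw [integral_finsetSum _ fun q _ => (integrable_pow_poissonMeasure _ _).const_mul _]
  refine Finset.sum_congr rfl fun q _ => ?_
  -- Since `r` is positive, the truncation in `Real.toNNReal` changes nothing.
  have hc : ((Real.toNNReal (r * n) : ℝ) : ℂ) = r * n := by
    rw [Real.coe_toNNReal _ (by positivity)]
    push_cast
    rfl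
  rw [integral_const_mul, integral_pow_poissonMeasure, hc]

end

/-! ### The set of reduced configuration basis numbers -/

/-- Quadruples of weight `n` are multisets of size `n` on four letters. -/
lemma card_reducedConfigs (n : ℕ) : (reducedConfigs n).card = (n + 3).choose 3 := by
  have h := congrArg Finset.card
    (Finset.map_sym_eq_piAntidiag (Finset.univ : Finset (Bool × Bool)) n)
  rw [Finset.card_map, Finset.sym_univ, Finset.card_univ, Sym.card_sym_eq_choose] at h
  rw [reducedConfigs, ← h, Fintype.card_prod, Fintype.card_bool,
    show 2 * 2 + n - 1 = n + 3 by omega, Nat.choose_symm_add]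

lemma card_reducedConfigs_le {n : ℕ} (hn : 1 ≤ n) : (reducedConfigs n).card ≤ 4 * n ^ 3 := by
  rw [card_reducedConfigs]
  have h : (n + 3).choose 3 * 6 = (n + 3) * (n + 2) * (n + 1) := by
    rw [show 6 = Nat.factorial 3 from rfl, mul_comm, ← Nat.descFactorial_eq_factorial_mul_choose]
    simp [Nat.descFactorial]
    ring
  -- Each factor is bounded using `1 ≤ n`; the right side is `24 n³`, and dividing by `3! = 6` gives
  -- the constant `4`.
  have h2 : (n + 3) * (n + 2) * (n + 1) ≤ (4 * n) * (3 * n) * (2 * n) := by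
    gcongr <;> omega
  nlinarith

/-- The nested form matches the loops of the program: `q_00`, then `q_10`, then `q_11`, with `q_01`
as remainder. -/
lemma sum_reducedConfigs (n : ℕ) (f : (Bool × Bool → ℕ) → ℂ) :
    ∑ q ∈ reducedConfigs n, f q =
      ∑ a ∈ Finset.range (n + 1), ∑ b ∈ Finset.range (n - a + 1),
        ∑ c ∈ Finset.range (n - a - b + 1), f (quadruple a (n - a - b - c) b c) := by
  have hsum : ∀ q : Bool × Bool → ℕ, ∑ i, q i =
      q (true, true) + q (true, false) + (q (false, true) + q (false, false)) := by
    intro q; simp [Fintype.sum_prod_type]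
  simp_rw [Finset.sum_sigma']
  refine Finset.sum_nbij'
    (fun q => (⟨q (false, false), q (true, false), q (true, true)⟩ : (_ : ℕ) × (_ : ℕ) × ℕ))
    (fun p => quadruple p.1 (n - p.1 - p.2.1 - p.2.2) p.2.1 p.2.2) ?_ ?_ ?_ ?_ ?_
  · intro q hq
    rw [mem_reducedConfigs, hsum] at hq
    simp only [Finset.mem_sigma, Finset.mem_range]
    omega
  · rintro ⟨a, b, c⟩ hp
    simp only [Finset.mem_sigma, Finset.mem_range] at hp
    rw [mem_reducedConfigs, hsum]
    simp only [quadruple]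
    omega
  · intro q hq
    rw [mem_reducedConfigs, hsum] at hq
    ext ⟨x, y⟩
    cases x <;> cases y <;> simp only [quadruple]
    omega
  · rintro ⟨a, b, c⟩ _
    rfl
  · intro q hq
    rw [mem_reducedConfigs, hsum] at hq
    congr 1
    ext ⟨x, y⟩
    cases x <;> cases y <;> simp only [quadruple]
    omega

/-- The weight of a quadruple as a product of binomial weights. -/
lemma mixerWeight_quadruple (β : ℝ) {n a b c : ℕ} (ha : a ≤ n) (hb : b ≤ n - a)
    (hc : c ≤ n - a - b) :
    mixerWeight n β (quadruple a (n - a - b - c) b c) =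
      (n.choose a * ((Real.cos (β / 2) : ℂ) ^ 2) ^ a) *
      ((n - a).choose b * ((Real.sin (β / 2) : ℂ) ^ 2) ^ b) *
      (-(Complex.I * (Real.sin β : ℂ) / 2)) ^ (n - a - b) *
      ((-1) ^ c * (n - a - b).choose c) := by
  obtain ⟨d, hd⟩ := Nat.exists_eq_add_of_le hc
  have e1 : n - a = b + (c + d) := by omega
  have e2 : n = a + (b + (c + d)) := by omega
  have e3 : n - a - b = c + d := by omega
  have hm : n.factorial / ∏ bc, (quadruple a (n - a - b - c) b c bc).factorial =
      n.choose a * (n - a).choose b * (n - a - b).choose c := by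
    simp only [Fintype.prod_prod_type, Fintype.prod_bool, quadruple]
    refine Nat.div_eq_of_eq_mul_left (by positivity) ?_
    rw [← Nat.choose_mul_factorial_mul_factorial ha,
      ← Nat.choose_mul_factorial_mul_factorial hb, ← Nat.choose_mul_factorial_mul_factorial hc]
    ring
  unfold mixerWeight
  rw [hm]
  simp only [quadruple]
  rw [show n - a - b - c = d by omega, e3, pow_add, neg_pow _ c, neg_pow _ d]
  -- The two off-diagonal mixer factors differ by a sign, so they merge into one power of exponent
  -- `c + d` at the price of `(-1)^c`.
  have hsq : ((-1 : ℂ) ^ c) * (-1) ^ c = 1 := by rw [← mul_pow]; simp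
  push_cast
  linear_combination (-(n.choose a * (n - a).choose b * (c + d).choose c *
    ((Complex.cos (β / 2)) ^ 2) ^ a * ((Complex.sin (β / 2)) ^ 2) ^ b *
    (Complex.I * (Complex.sin β) / 2) ^ c * ((-1) ^ d * (Complex.I * (Complex.sin β) / 2) ^ d))) * hsq

/-! ### Running programs -/

/-- Sequential composition of several programs. -/
def Program.chain (p : Program) (l : List Program) : Program := l.foldl .seq p

variable {F : (Bool × Bool → ℕ) → ℂ}

lemma Program.run_seq (p q : Program) (s : MachineState) :
    (p.seq q).run F s = q.run F (p.run F s) := rfl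

/-- The number of iterations is read at entry, so the body may overwrite counter `i`. Nested loops
exploit this by all using counter `8`. -/
lemma Program.run_loop_induction {I : ℕ → MachineState → Prop} {i : ℕ} {body : Program}
    {s : MachineState} (h0 : I 0 s.tick)
    (hs : ∀ k u, k < s.counter i → I k u → I (k + 1) (body.run F u).tick) :
    I (s.counter i) ((Program.loop i body).run F s) := by
  have h : ∀ k ≤ s.counter i, I k ((fun u => (body.run F u).tick)^[k] s.tick) := by
    intro k
    induction k with
    | zero => exact fun _ => h0
    | succ k ih =>
      intro hk
      rw [Function.iterate_succ_apply']
      exact hs k _ hk (ih (by omega))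
  exact h _ le_rfl

/-- Two states agree on the first `i₀` counters and the first `a₀` scalar registers. -/
def MachineState.AgreeBelow (i₀ a₀ : ℕ) (s u : MachineState) : Prop :=
  (∀ i < i₀, u.counter i = s.counter i) ∧ ∀ a < a₀, u.scalar a = s.scalar a

/-- `post` applies `g` to the scalar register `18`, with `p` powers and `c` other operations, as soon
as counter `1` holds `m`, scalar `4` holds `1` and scalar `14` holds `ρ`. -/
def AppliesTo (F : (Bool × Bool → ℕ) → ℂ) (post : Program) (g : ℂ → ℂ) (m : ℕ) (ρ : ℂ)
    (p c : ℕ) : Prop :=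
  ∀ s : MachineState, s.counter 1 = m → s.scalar 4 = 1 → s.scalar 14 = ρ →
    post.run F s = { s with
      scalar := Function.update s.scalar 18 (g (s.scalar 18))
      powers := s.powers + p
      ops := s.ops + c }

/-- Add one term, and update the signed binomial weight. -/
def termProgram (post : Program) : Program :=
  -- Counters `2, 7, 4, 6` hold `q_00, q_01, q_10, q_11`; counters `3` and `5` hold `n - q_00` and
  -- `n - q_00 - q_10`. Scalars `15, 16, 17` hold the partial weights of the three nested loops,
  -- `18` is scratch and `19` accumulates the sum.
  Program.chain (.op (.query 18 2 7 4 6)) [post,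
    .op (.times 18 18 17), .op (.plus 19 19 18),
    .op (.cast 18 7), .op (.times 17 17 18), .op (.succ 6), .op (.cast 18 6),
    .op (.divide 17 17 18), .op (.minus 17 13 17), .op (.pred 7)]

/-- Add the terms with given first and third entry of the quadruple. -/
def columnProgram (post : Program) : Program :=
  Program.chain (.op (.zero 6)) [.op (.copy 7 5), .op (.move 17 16),
    -- Repeated multiplication avoids the power operation; its linear cost is absorbed by the terms
    -- of the column.
    .loop 5 (.op (.times 17 17 12)), .op (.copy 8 5), .op (.succ 8), .loop 8 (termProgram post)]

/-- Add the terms with given first entry of the quadruple. -/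
def rowProgram (post : Program) : Program :=
  Program.chain (.op (.zero 4)) [.op (.copy 5 3), .op (.move 16 15), .op (.copy 8 3),
    .op (.succ 8), .loop 8 (Program.chain (columnProgram post) [
      .op (.cast 18 5), .op (.times 16 16 18), .op (.succ 4), .op (.cast 18 4),
      .op (.divide 16 16 18), .op (.times 16 16 10), .op (.pred 5)])]

/-- Compute `1`, `cos² (β/2)`, `sin² (β/2)`, `-i (sin β)/2`, `0` and `r n` from `β`, `r` and `n`. -/
def constantsProgram : Program :=
  Program.chain (.op (.imag 3)) [.op (.zero 8), .op (.succ 8), .op (.cast 4 8), .op (.plus 5 4 4),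
    -- Scalars `7` and `8` become `exp (± iβ/2)`; their half sum and half difference are `cos (β/2)`
    -- and `i sin (β/2)`, from which all mixer factors follow by products.
    .op (.times 6 0 3), .op (.divide 6 6 5), .op (.expo 7 6), .op (.divide 8 4 7),
    .op (.plus 9 7 8), .op (.divide 9 9 5), .op (.minus 10 7 8), .op (.divide 10 10 5),
    .op (.minus 13 4 4), .op (.times 12 9 10), .op (.minus 12 13 12), .op (.times 9 9 9),
    .op (.times 10 10 10), .op (.minus 10 13 10), .op (.cast 14 0), .op (.times 14 1 14),
    .op (.move 19 13)]

/-- Compute the constants and add all terms. -/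
def sumProgram (post : Program) : Program :=
  Program.chain constantsProgram [.op (.zero 2), .op (.copy 3 0), .op (.move 15 4),
    .op (.copy 8 0), .op (.succ 8), .loop 8 (Program.chain (rowProgram post) [
      .op (.cast 18 3), .op (.times 15 15 18), .op (.succ 2), .op (.cast 18 2),
      .op (.divide 15 15 18), .op (.times 15 15 9), .op (.pred 3)]),
    .op (.move 0 19)]

/-! ### Correctness and operation counts of the summation program -/

/-- This ratio drives the weight updates of all three loops. Truncated subtraction keeps it valid
after the last term, when the weight becomes `0`. -/
lemma choose_succ_cast (B k : ℕ) :
    ((B.choose (k + 1) : ℕ) : ℂ) = B.choose k * ((B - k : ℕ) : ℂ) / ((k + 1 : ℕ) : ℂ) := by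
  rw [eq_div_iff (by exact_mod_cast k.succ_ne_zero)]
  exact_mod_cast Nat.choose_succ_right_eq B k

section

variable {post : Program} {g : ℂ → ℂ} {m p c : ℕ} {ρ : ℂ}

lemma termProgram_run (hpost : AppliesTo F post g m ρ p c) (s : MachineState)
    (h1 : s.counter 1 = m) (h4 : s.scalar 4 = 1) (h13 : s.scalar 13 = 0)
    (h14 : s.scalar 14 = ρ) :
    s.AgreeBelow 6 17 ((termProgram post).run F s) ∧
    ((termProgram post).run F s).counter 6 = s.counter 6 + 1 ∧
    ((termProgram post).run F s).counter 7 = s.counter 7 - 1 ∧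
    ((termProgram post).run F s).scalar 17 =
      -(s.scalar 17 * s.counter 7 / ((s.counter 6 + 1 : ℕ) : ℂ)) ∧
    ((termProgram post).run F s).scalar 19 = s.scalar 19 + g (F (quadruple (s.counter 2)
      (s.counter 7) (s.counter 4) (s.counter 6))) * s.scalar 17 ∧
    ((termProgram post).run F s).evals = s.evals + 1 ∧
    ((termProgram post).run F s).powers = s.powers + p ∧
    ((termProgram post).run F s).ops = s.ops + c + 9 := by
  unfold termProgram
  simp only [Program.chain, List.foldl, Program.run]
  rw [hpost _ (by simpa [Operation.exec, MachineState.setScalar] using h1)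
    (by simpa [Operation.exec, MachineState.setScalar] using h4)
    (by simpa [Operation.exec, MachineState.setScalar] using h14)]
  simp only [Operation.exec, MachineState.setScalar, MachineState.setCounter, MachineState.tick]
  refine ⟨⟨fun i hi => ?_, fun a ha => ?_⟩, ?_, ?_, ?_, ?_, ?_, ?_, ?_⟩
  · have : i ≠ 6 ∧ i ≠ 7 := by omega
    simp [this]
  · have : a ≠ 17 ∧ a ≠ 18 ∧ a ≠ 19 := by omega
    simp [this]
  all_goals simp [h13]

lemma columnProgram_run (hpost : AppliesTo F post g m ρ p c) (s : MachineState)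
    (h1 : s.counter 1 = m) (h4 : s.scalar 4 = 1) (h13 : s.scalar 13 = 0)
    (h14 : s.scalar 14 = ρ) :
    s.AgreeBelow 6 17 ((columnProgram post).run F s) ∧
    ((columnProgram post).run F s).scalar 19 = s.scalar 19 +
      ∑ d ∈ Finset.range (s.counter 5 + 1), s.scalar 16 * s.scalar 12 ^ s.counter 5 *
        ((-1) ^ d * (s.counter 5).choose d) *
        g (F (quadruple (s.counter 2) (s.counter 5 - d) (s.counter 4) d)) ∧
    ((columnProgram post).run F s).evals = s.evals + (s.counter 5 + 1) ∧
    ((columnProgram post).run F s).powers = s.powers + (s.counter 5 + 1) * p ∧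
    ((columnProgram post).run F s).ops =
      s.ops + (7 + 2 * s.counter 5 + (s.counter 5 + 1) * (c + 10)) := by
  unfold columnProgram
  simp only [Program.chain, List.foldl]
  simp only [Program.run_seq]
  set s₁ := (Program.op (.move 17 16)).run F
    ((Program.op (.copy 7 5)).run F ((Program.op (.zero 6)).run F s)) with hs₁
  have hpow := Program.run_loop_induction (F := F) (i := 5) (body := .op (.times 17 17 12))
    (s := s₁) (I := fun k u => s.AgreeBelow 6 17 u ∧ u.counter 6 = 0 ∧
      u.counter 7 = s.counter 5 ∧ u.scalar 17 = s.scalar 16 * s.scalar 12 ^ k ∧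
      u.scalar 19 = s.scalar 19 ∧ u.evals = s.evals ∧ u.powers = s.powers ∧
      u.ops = s.ops + 4 + 2 * k) ?_ ?_
  rotate_left
  · rw [hs₁]
    simp only [Program.run, Operation.exec, MachineState.setScalar, MachineState.setCounter,
      MachineState.tick]
    refine ⟨⟨fun i hi => ?_, fun a ha => ?_⟩, ?_⟩
    · have : i ≠ 6 ∧ i ≠ 7 := by omega
      simp [this]
    · have : a ≠ 17 := by omega
      simp [this]
    · simp
  · rintro k u - ⟨⟨hc, ha⟩, h6, h7, h17, h19, he, hp, ho⟩
    simp only [Program.run, Operation.exec, MachineState.setScalar, MachineState.tick]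
    refine ⟨⟨hc, fun a ha' => ?_⟩, ?_⟩
    · have : a ≠ 17 := by omega
      simp [this, ha a ha']
    · simp [h6, h7, h17, h19, he, hp, ho, ha 12]
      constructor
      · ring
      · ring
  have h5 : s₁.counter 5 = s.counter 5 := by
    simp [hs₁, Program.run, Operation.exec, MachineState.setScalar, MachineState.setCounter,
      MachineState.tick]
  rw [h5] at hpow
  generalize (Program.loop 5 (.op (.times 17 17 12))).run F s₁ = s₂ at hpow ⊢
  clear_value s₁
  obtain ⟨⟨hc, ha⟩, h6, h7, h17, h19, he, hp, ho⟩ := hpow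
  set s₃ := (Program.op (.succ 8)).run F ((Program.op (.copy 8 5)).run F s₂) with hs₃
  have hloop := Program.run_loop_induction (F := F) (i := 8) (body := termProgram post)
    (s := s₃) (I := fun k u => s.AgreeBelow 6 17 u ∧ u.counter 6 = k ∧
      u.counter 7 = s.counter 5 - k ∧
      u.scalar 17 = s.scalar 16 * s.scalar 12 ^ s.counter 5 *
        ((-1) ^ k * (s.counter 5).choose k) ∧
      u.scalar 19 = s.scalar 19 +
        ∑ d ∈ Finset.range k, s.scalar 16 * s.scalar 12 ^ s.counter 5 *
          ((-1) ^ d * (s.counter 5).choose d) *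
          g (F (quadruple (s.counter 2) (s.counter 5 - d) (s.counter 4) d)) ∧
      u.evals = s.evals + k ∧ u.powers = s.powers + k * p ∧
      u.ops = s.ops + 7 + 2 * s.counter 5 + k * (c + 10)) ?_ ?_
  · have h8 : s₃.counter 8 = s.counter 5 + 1 := by
      simp [hs₃, Program.run, Operation.exec, MachineState.setCounter, MachineState.tick, hc 5]
    rw [h8] at hloop
    obtain ⟨hagree, -, -, -, h19', he', hp', ho'⟩ := hloop
    exact ⟨hagree, h19', he', hp', by rw [ho']; ring⟩
  · rw [hs₃]
    simp only [Program.run, Operation.exec, MachineState.setCounter, MachineState.tick]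
    refine ⟨⟨fun i hi => ?_, ha⟩, ?_⟩
    · have : i ≠ 8 := by omega
      simp [this, hc i hi]
    · simp [h6, h7, h17, h19, he, hp, ho]
      ring
  · rintro k u - ⟨⟨hc', ha'⟩, h6', h7', h17', h19', he', hp', ho'⟩
    obtain ⟨⟨tc, ta⟩, t6, t7, t17, t19, te, tp, t_o⟩ := termProgram_run hpost u
      ((hc' 1 (by norm_num)).trans h1) ((ha' 4 (by norm_num)).trans h4)
      ((ha' 13 (by norm_num)).trans h13) ((ha' 14 (by norm_num)).trans h14)
    simp only [MachineState.tick]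
    refine ⟨⟨fun i hi => (tc i hi).trans (hc' i hi), fun a h => (ta a h).trans (ha' a h)⟩,
      by rw [t6, h6'], by rw [t7, h7']; omega, ?_, ?_, by rw [te, he']; ring,
      by rw [tp, hp']; ring, by rw [t_o, ho']; ring⟩
    · rw [t17, h17', h7', h6', choose_succ_cast]
      ring
    · rw [t19, h19', Finset.sum_range_succ, h17', h7', h6', hc' 2 (by norm_num),
        hc' 4 (by norm_num)]
      ring

lemma rowProgram_run (hpost : AppliesTo F post g m ρ p c) (s : MachineState)
    (h1 : s.counter 1 = m) (h4 : s.scalar 4 = 1) (h13 : s.scalar 13 = 0)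
    (h14 : s.scalar 14 = ρ) :
    s.AgreeBelow 4 16 ((rowProgram post).run F s) ∧
    ((rowProgram post).run F s).scalar 19 = s.scalar 19 +
      ∑ b ∈ Finset.range (s.counter 3 + 1), ∑ d ∈ Finset.range (s.counter 3 - b + 1),
        s.scalar 15 * ((s.counter 3).choose b * s.scalar 10 ^ b) *
          s.scalar 12 ^ (s.counter 3 - b) * ((-1) ^ d * (s.counter 3 - b).choose d) *
          g (F (quadruple (s.counter 2) (s.counter 3 - b - d) b d)) ∧
    ((rowProgram post).run F s).evals ≤ s.evals + (s.counter 3 + 1) ^ 2 ∧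
    ((rowProgram post).run F s).powers ≤ s.powers + (s.counter 3 + 1) ^ 2 * p ∧
    ((rowProgram post).run F s).ops ≤ s.ops + (s.counter 3 + 1) ^ 2 * (c + 31) := by
  unfold rowProgram
  simp only [Program.chain, List.foldl]
  simp only [Program.run_seq]
  set s₁ := (Program.op (.succ 8)).run F ((Program.op (.copy 8 3)).run F
    ((Program.op (.move 16 15)).run F
    ((Program.op (.copy 5 3)).run F ((Program.op (.zero 4)).run F s)))) with hs₁
  have hloop := Program.run_loop_induction (F := F) (i := 8)
    (body := ((((((((columnProgram post).seq (.op (.cast 18 5))).seq (.op (.times 16 16 18))).seq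
      (.op (.succ 4))).seq (.op (.cast 18 4))).seq (.op (.divide 16 16 18))).seq
      (.op (.times 16 16 10))).seq (.op (.pred 5))))
    (s := s₁) (I := fun k u => s.AgreeBelow 4 16 u ∧ u.counter 4 = k ∧
      u.counter 5 = s.counter 3 - k ∧
      u.scalar 16 = s.scalar 15 * ((s.counter 3).choose k * s.scalar 10 ^ k) ∧
      u.scalar 19 = s.scalar 19 +
        ∑ b ∈ Finset.range k, ∑ d ∈ Finset.range (s.counter 3 - b + 1),
        s.scalar 15 * ((s.counter 3).choose b * s.scalar 10 ^ b) *
          s.scalar 12 ^ (s.counter 3 - b) * ((-1) ^ d * (s.counter 3 - b).choose d) *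
          g (F (quadruple (s.counter 2) (s.counter 3 - b - d) b d)) ∧
      u.evals ≤ s.evals + k * (s.counter 3 + 1) ∧
      u.powers ≤ s.powers + k * (s.counter 3 + 1) * p ∧
      u.ops ≤ s.ops + 6 + k * ((s.counter 3 + 1) * (c + 17) + 8)) ?_ ?_
  · have h8 : s₁.counter 8 = s.counter 3 + 1 := by
      simp [hs₁, Program.run, Operation.exec, MachineState.setCounter, MachineState.setScalar,
        MachineState.tick]
    rw [h8] at hloop
    obtain ⟨hagree, -, -, -, h19, he, hp, ho⟩ := hloop
    refine ⟨hagree, h19, he.trans_eq (by ring), hp.trans_eq (by ring), ho.trans ?_⟩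
    -- The constant is `31 = 17 + 8 + 6`: the column bound, the update after each column, and the
    -- setup.
    nlinarith [Nat.zero_le (s.counter 3)]
  · rw [hs₁]
    simp only [Program.run, Operation.exec, MachineState.setCounter, MachineState.setScalar,
      MachineState.tick]
    refine ⟨⟨fun i hi => ?_, fun a ha => ?_⟩, ?_⟩
    · have : i ≠ 4 ∧ i ≠ 5 ∧ i ≠ 8 := by omega
      simp [this]
    · have : a ≠ 16 := by omega
      simp [this]
    · simp
  · rintro k u - ⟨⟨hc', ha'⟩, h4', h5', h16', h19', he', hp', ho'⟩
    obtain ⟨⟨tc, ta⟩, t19, te, tp, t_o⟩ := columnProgram_run hpost u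
      ((hc' 1 (by norm_num)).trans h1) ((ha' 4 (by norm_num)).trans h4)
      ((ha' 13 (by norm_num)).trans h13) ((ha' 14 (by norm_num)).trans h14)
    simp only [Program.run_seq]
    generalize (columnProgram post).run F u = w at *
    simp only [Program.run, Operation.exec, MachineState.setCounter, MachineState.setScalar,
      MachineState.tick]
    have hle : s.counter 3 - k + 1 ≤ s.counter 3 + 1 := by omega
    rw [h5'] at te tp t_o
    refine ⟨⟨fun i hi => ?_, fun a ha => ?_⟩, ?_, ?_, ?_, ?_, ?_, ?_, ?_⟩
    · have : i ≠ 4 ∧ i ≠ 5 := by omega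
      simp [this, tc i (by omega), hc' i hi]
    · have : a ≠ 16 ∧ a ≠ 18 := by omega
      simp [this, ta a (by omega), ha' a ha]
    · simp [tc 4, h4']
    · simp [tc 5, h5']
      omega
    · simp [tc 4, tc 5, ta 16, ta 10, ha' 10, h4', h5', h16', choose_succ_cast]
      ring
    · simp [t19, h19', Finset.sum_range_succ _ k, h16', h5', h4', hc' 2, ha' 12,
        add_assoc]
    · simp only [te]
      nlinarith
    · simp only [tp]
      nlinarith [Nat.mul_le_mul_right p hle]
    · simp only [t_o]
      -- With `B` the remaining weight, the exact column cost is at most `(B + 1) (c + 17)`, because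
      -- `7 + 2 B ≤ 7 (B + 1)`.
      nlinarith [Nat.mul_le_mul_right (c + 17) hle]

lemma sumProgram_loop_run (hpost : AppliesTo F post g m ρ p c) (s : MachineState)
    (h1 : s.counter 1 = m) (h4 : s.scalar 4 = 1) (h13 : s.scalar 13 = 0)
    (h14 : s.scalar 14 = ρ) (h3 : s.counter 3 = s.counter 0) (h2 : s.counter 2 = 0)
    (h15 : s.scalar 15 = 1) (h8 : s.counter 8 = s.counter 0 + 1) (h19 : s.scalar 19 = 0)
    {u : MachineState}
    (hu : u = (Program.loop 8 (Program.chain (rowProgram post) [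
      .op (.cast 18 3), .op (.times 15 15 18), .op (.succ 2), .op (.cast 18 2),
      .op (.divide 15 15 18), .op (.times 15 15 9), .op (.pred 3)])).run F s) :
    u.scalar 19 = ∑ a ∈ Finset.range (s.counter 0 + 1),
      ∑ b ∈ Finset.range (s.counter 0 - a + 1), ∑ d ∈ Finset.range (s.counter 0 - a - b + 1),
        ((s.counter 0).choose a * s.scalar 9 ^ a) *
        ((s.counter 0 - a).choose b * s.scalar 10 ^ b) *
          s.scalar 12 ^ (s.counter 0 - a - b) * ((-1) ^ d * (s.counter 0 - a - b).choose d) *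
          g (F (quadruple a (s.counter 0 - a - b - d) b d)) ∧
    u.evals ≤ s.evals + (s.counter 0 + 1) ^ 3 ∧
    u.powers ≤ s.powers + (s.counter 0 + 1) ^ 3 * p ∧
    u.ops ≤ s.ops + 1 + (s.counter 0 + 1) ^ 3 * (c + 39) := by
  have hloop := Program.run_loop_induction (F := F) (i := 8)
    (body := Program.chain (rowProgram post) [
      .op (.cast 18 3), .op (.times 15 15 18), .op (.succ 2), .op (.cast 18 2),
      .op (.divide 15 15 18), .op (.times 15 15 9), .op (.pred 3)])
    (s := s) (I := fun k u => s.AgreeBelow 2 15 u ∧ u.counter 2 = k ∧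
      u.counter 3 = s.counter 0 - k ∧
      u.scalar 15 = (s.counter 0).choose k * s.scalar 9 ^ k ∧
      u.scalar 19 = ∑ a ∈ Finset.range k,
      ∑ b ∈ Finset.range (s.counter 0 - a + 1), ∑ d ∈ Finset.range (s.counter 0 - a - b + 1),
        ((s.counter 0).choose a * s.scalar 9 ^ a) *
        ((s.counter 0 - a).choose b * s.scalar 10 ^ b) *
          s.scalar 12 ^ (s.counter 0 - a - b) * ((-1) ^ d * (s.counter 0 - a - b).choose d) *
          g (F (quadruple a (s.counter 0 - a - b - d) b d)) ∧
      u.evals ≤ s.evals + k * (s.counter 0 + 1) ^ 2 ∧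
      u.powers ≤ s.powers + k * (s.counter 0 + 1) ^ 2 * p ∧
      u.ops ≤ s.ops + 1 + k * ((s.counter 0 + 1) ^ 2 * (c + 39))) ?_ ?_
  · rw [← hu, h8] at hloop
    obtain ⟨-, -, -, -, h19, he, hp, ho⟩ := hloop
    exact ⟨h19, he.trans_eq (by ring), hp.trans_eq (by ring), ho.trans_eq (by ring)⟩
  · simp only [MachineState.tick]
    refine ⟨⟨fun i hi => rfl, fun a ha => rfl⟩, ?_⟩
    simp [h2, h3, h15, h19]
  · rintro k u - ⟨⟨hc', ha'⟩, h2', h3', h15', h19', he', hp', ho'⟩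
    obtain ⟨⟨tc, ta⟩, t19, te, tp, t_o⟩ := rowProgram_run hpost u
      ((hc' 1 (by norm_num)).trans h1) ((ha' 4 (by norm_num)).trans h4)
      ((ha' 13 (by norm_num)).trans h13) ((ha' 14 (by norm_num)).trans h14)
    simp only [Program.chain, List.foldl]
    simp only [Program.run_seq]
    generalize (rowProgram post).run F u = w at *
    simp only [Program.run, Operation.exec, MachineState.setCounter, MachineState.setScalar,
      MachineState.tick]
    have hle : (s.counter 0 - k + 1) ^ 2 ≤ (s.counter 0 + 1) ^ 2 :=
      Nat.pow_le_pow_left (by omega) 2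
    have hone : 1 ≤ (s.counter 0 + 1) ^ 2 := Nat.one_le_pow _ _ (by omega)
    rw [h3'] at te tp t_o
    refine ⟨⟨fun i hi => ?_, fun a ha => ?_⟩, ?_, ?_, ?_, ?_, ?_, ?_, ?_⟩
    · have : i ≠ 2 ∧ i ≠ 3 := by omega
      simp [this, tc i (by omega), hc' i hi]
    · have : a ≠ 15 ∧ a ≠ 18 := by omega
      simp [this, ta a (by omega), ha' a ha]
    · simp [tc 2, h2']
    · simp [tc 3, h3']
      omega
    · simp [tc 2, tc 3, ta 15, ta 9, ha' 9, h2', h3', h15', choose_succ_cast]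
      ring
    · simp [t19, h19', Finset.sum_range_succ _ k, h15', h2', h3', ha' 10, ha' 12]
    · nlinarith
    · nlinarith [Nat.mul_le_mul_right p hle]
    · nlinarith [Nat.mul_le_mul_right (c + 31) hle]

end

lemma constantsProgram_run (s : MachineState) {n : ℕ} {β : ℝ} {r : ℂ} (hn : s.counter 0 = n)
    (hβ : s.scalar 0 = β) (hr : s.scalar 1 = r) {u : MachineState}
    (hu : u = constantsProgram.run F s) :
    u.counter 0 = n ∧ u.counter 1 = s.counter 1 ∧ u.scalar 4 = 1 ∧
    u.scalar 9 = (Real.cos (β / 2) : ℂ) ^ 2 ∧ u.scalar 10 = (Real.sin (β / 2) : ℂ) ^ 2 ∧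
    u.scalar 12 = -(Complex.I * (Real.sin β : ℂ) / 2) ∧ u.scalar 13 = 0 ∧
    u.scalar 14 = r * n ∧ u.scalar 19 = 0 ∧
    u.evals = s.evals ∧ u.powers = s.powers ∧ u.ops = s.ops + 22 := by
  have hexp : Complex.exp (β * Complex.I / 2) =
      Complex.cos (β / 2) + Complex.sin (β / 2) * Complex.I := by
    rw [← Complex.exp_mul_I]; congr 1; ring
  have hinv : 1 / (Complex.cos (β / 2) + Complex.sin (β / 2) * Complex.I) =
      Complex.cos (β / 2) - Complex.sin (β / 2) * Complex.I := by
    rw [← Complex.exp_mul_I, one_div, ← Complex.exp_neg, ← neg_mul, Complex.exp_mul_I,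
      Complex.cos_neg, Complex.sin_neg]
    ring
  have hsin : Complex.sin β = 2 * Complex.sin (β / 2) * Complex.cos (β / 2) := by
    rw [← Complex.sin_two_mul]; congr 1; ring
  rw [hu]
  unfold constantsProgram
  simp only [Program.chain, List.foldl, Program.run, Operation.exec, MachineState.setCounter,
    MachineState.setScalar, MachineState.tick]
  simp [hn, hβ, hr, one_add_one_eq_two, hexp]
  simp only [← one_div, hinv, hsin]
  refine ⟨by ring, ?_, by ring⟩
  linear_combination (-(Complex.sin (β / 2)) ^ 2) * Complex.I_sq

/-- The program computes the weighted sum of the post-processed values of the black-box function. -/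
lemma sumProgram_run {post : Program} {g : ℂ → ℂ} {n m p c : ℕ} {β : ℝ} {r : ℂ}
    (hn : 1 ≤ n) (hpost : AppliesTo F post g m (r * n) p c) {ns : List ℕ} {cs : List ℂ}
    (hns : ns.getD 0 0 = n) (hm : ns.getD 1 0 = m) (hβ : cs.getD 0 0 = β) (hr : cs.getD 1 0 = r)
    {u : MachineState} (hu : u = (sumProgram post).run F (MachineState.init ns cs)) :
    u.scalar 0 = ∑ q ∈ reducedConfigs n, mixerWeight n β q * g (F q) ∧
    u.evals ≤ 8 * n ^ 3 ∧ u.powers ≤ 8 * p * n ^ 3 ∧ u.ops ≤ (8 * c + 341) * n ^ 3 := by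
  unfold sumProgram at hu
  simp only [Program.chain, List.foldl] at hu
  simp only [Program.run_seq] at hu
  obtain ⟨c0, c1, c4, c9, c10, c12, c13, c14, c19, ce, cp, co⟩ :=
    constantsProgram_run (F := F) (MachineState.init ns cs) hns hβ hr rfl
  replace c1 := c1.trans hm
  generalize constantsProgram.run F (MachineState.init ns cs) = s₁ at *
  set s₂ := (Program.op (.succ 8)).run F ((Program.op (.copy 8 0)).run F
    ((Program.op (.move 15 4)).run F
    ((Program.op (.copy 3 0)).run F ((Program.op (.zero 2)).run F s₁)))) with hs₂
  have e0 : s₂.counter 0 = n := by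
    simp [hs₂, Program.run, Operation.exec, MachineState.setCounter, MachineState.setScalar,
      MachineState.tick, c0]
  obtain ⟨l19, le, lp, lo⟩ := sumProgram_loop_run hpost s₂ (u := _)
    (by simp [hs₂, Program.run, Operation.exec, MachineState.setCounter, MachineState.setScalar,
      MachineState.tick, c1])
    (by simpa [hs₂, Program.run, Operation.exec, MachineState.setCounter, MachineState.setScalar,
      MachineState.tick])
    (by simpa [hs₂, Program.run, Operation.exec, MachineState.setCounter, MachineState.setScalar,
      MachineState.tick])
    (by simpa [hs₂, Program.run, Operation.exec, MachineState.setCounter, MachineState.setScalar,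
      MachineState.tick])
    (by simp [hs₂, Program.run, Operation.exec, MachineState.setCounter, MachineState.setScalar,
      MachineState.tick])
    (by simp [hs₂, Program.run, Operation.exec, MachineState.setCounter, MachineState.setScalar,
      MachineState.tick])
    (by simpa [hs₂, Program.run, Operation.exec, MachineState.setCounter, MachineState.setScalar,
      MachineState.tick])
    (by simp [hs₂, Program.run, Operation.exec, MachineState.setCounter, MachineState.setScalar,
      MachineState.tick])
    (by simpa [hs₂, Program.run, Operation.exec, MachineState.setCounter, MachineState.setScalar,
      MachineState.tick])
    rfl
  have e9 : s₂.scalar 9 = s₁.scalar 9 ∧ s₂.scalar 10 = s₁.scalar 10 ∧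
      s₂.scalar 12 = s₁.scalar 12 ∧ s₂.evals = 0 ∧ s₂.powers = 0 ∧ s₂.ops = 27 := by
    simp [hs₂, Program.run, Operation.exec, MachineState.setCounter, MachineState.setScalar,
      MachineState.tick, ce, cp, co, MachineState.init]
  obtain ⟨e9, e10, e12, ee, ep, eo⟩ := e9
  rw [e0, e9, e10, e12, c9, c10, c12] at l19
  rw [e0] at le lp lo
  rw [ee] at le
  rw [ep] at lp
  rw [eo] at lo
  simp only [Program.chain, List.foldl] at l19 le lp lo
  generalize Program.run F (Program.loop 8 _) s₂ = s₃ at *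
  have h0 : u.scalar 0 = s₃.scalar 19 ∧ u.evals = s₃.evals ∧ u.powers = s₃.powers ∧
      u.ops = s₃.ops + 1 := by
    rw [hu]
    simp [Program.run, Operation.exec, MachineState.setScalar, MachineState.tick]
  obtain ⟨h0, he, hp, ho⟩ := h0
  have hcube : (n + 1) ^ 3 ≤ 8 * n ^ 3 := by
    calc (n + 1) ^ 3 ≤ (2 * n) ^ 3 := Nat.pow_le_pow_left (by omega) 3
      _ = 8 * n ^ 3 := by ring
  have hone : 1 ≤ n ^ 3 := Nat.one_le_pow _ _ (by omega)
  refine ⟨?_, ?_, ?_, ?_⟩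
  · rw [h0, l19, sum_reducedConfigs]
    refine Finset.sum_congr rfl fun a ha => Finset.sum_congr rfl fun b hb =>
      Finset.sum_congr rfl fun d hd => ?_
    rw [Finset.mem_range] at ha hb hd
    rw [mixerWeight_quadruple β (by omega) (by omega) (by omega)]
  · rw [he]; omega
  · rw [hp]; nlinarith [Nat.mul_le_mul_right p hcube]
  -- `341 = 8 * 39 + 29`, where `29` counts the constants (`22`), the setup (`5`), the loop entry
  -- and the final move.
  · rw [ho]; nlinarith [Nat.mul_le_mul_right (c + 39) hcube]

/-- The program that raises the black-box value to the power `m`. -/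
lemma appliesTo_power (m : ℕ) (ρ : ℂ) :
    AppliesTo F (.op (.power 18 18 1)) (fun w => w ^ m) m ρ 1 0 := by
  intro s h1 _ _
  simp [Program.run, Operation.exec, MachineState.setScalar, h1]

/-- The program that maps the black-box value `w` to `exp (ρ (w - 1))`. -/
lemma appliesTo_exp (m : ℕ) (ρ : ℂ) :
    AppliesTo F (Program.chain (.op (.minus 18 18 4)) [.op (.times 18 14 18), .op (.expo 18 18)])
      (fun w => Complex.exp (ρ * (w - 1))) m ρ 0 3 := by
  intro s _ h4 h14
  simp [Program.chain, Program.run, Operation.exec, MachineState.setScalar, MachineState.tick,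
    h4, h14]

end QAOA

theorem mainTheorem1 :
    -- the two formulas, for every random constraint satisfaction problem
    (∀ (k n : ℕ) (_ : 1 ≤ n) (T : TruthTable k) (γ β : ℝ) (_ : ClauseViolationAssumption T n),
      -- a single-clause polynomial exists, and its values at weight `n` are unique
      (∃ P, IsSingleClausePoly T n γ P) ∧
      (∀ P P', IsSingleClausePoly T n γ P → IsSingleClausePoly T n γ P' →
        ∀ q ∈ reducedConfigs n, polyValue P q = polyValue P' q) ∧
      -- the same average through satisfied clauses
      (∀ z : Triplet n, singleClauseAvg T γ z =
        ∫ s, Complex.exp (-(Complex.I * γ / 2) * (satInd T (z 0) s - satInd T (z 2) s)) *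
          satInd T (z 1) s ∂(clauseMeasure k n)) ∧
      -- the success probability of an instance as an expectation value
      (∀ (m : ℕ) (σ : Instance k n m), (successProb T γ β σ : ℂ) =
        star (qaoaState T γ β σ) ⬝ᵥ (solutionProjector T σ *ᵥ qaoaState T γ β σ)) ∧
      ∀ P, IsSingleClausePoly T n γ P →
        -- fixed number of clauses
        (∀ m : ℕ, (avgSuccessProb T n γ β m : ℂ) =
          ∑ q ∈ reducedConfigs n, mixerWeight n β q * polyValue P q ^ m) ∧
        -- Poisson number of clauses
        (∀ r : ℝ, 0 < r →
          Integrable (avgSuccessProb T n γ β) (poissonMeasure (Real.toNNReal (r * n))) ∧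
          (poissonAvgSuccessProb T n γ β r : ℂ) =
            ∑ q ∈ reducedConfigs n,
              mixerWeight n β q * Complex.exp (r * n * (polyValue P q - 1)))) ∧
    -- the number of terms
    (∀ n : ℕ, 1 ≤ n →
      (reducedConfigs n).card = (n + 3).choose 3 ∧ (reducedConfigs n).card ≤ 4 * n ^ 3) ∧
    -- the algorithm for a fixed number of clauses
    (∃ (prog : Program) (C : ℕ), ∀ (k n : ℕ) (_ : 1 ≤ n) (T : TruthTable k) (γ β : ℝ)
      (_ : ClauseViolationAssumption T n) (P : MvPolynomial (Bool × Bool) ℂ)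
      (_ : IsSingleClausePoly T n γ P) (m : ℕ)
      (final : MachineState)
      (_ : final = prog.run (polyValue P) (MachineState.init [n, m] [(β : ℂ)])),
      final.scalar 0 = (avgSuccessProb T n γ β m : ℂ) ∧
        final.evals ≤ C * n ^ 3 ∧ final.ops + final.powers ≤ C * n ^ 3) ∧
    -- the algorithm for a Poisson number of clauses
    (∃ (prog : Program) (C : ℕ), ∀ (k n : ℕ) (_ : 1 ≤ n) (T : TruthTable k) (γ β : ℝ)
      (_ : ClauseViolationAssumption T n) (P : MvPolynomial (Bool × Bool) ℂ)
      (_ : IsSingleClausePoly T n γ P) (r : ℝ) (_ : 0 < r)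
      (final : MachineState)
      (_ : final = prog.run (polyValue P) (MachineState.init [n] [(β : ℂ), (r : ℂ)])),
      final.scalar 0 = (poissonAvgSuccessProb T n γ β r : ℂ) ∧
        final.evals ≤ C * n ^ 3 ∧ final.powers = 0 ∧ final.ops ≤ C * n ^ 3) := by
  refine ⟨?_, fun n hn => ⟨card_reducedConfigs n, card_reducedConfigs_le hn⟩, ?_, ?_⟩
  · intro k n hn T γ β hT
    have : NeZero n := ⟨by omega⟩
    exact ⟨exists_isSingleClausePoly γ hT,
      fun P P' hP hP' q hq => polyValue_eq_of_isSingleClausePoly hP hP' hq,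
      singleClauseAvg_eq_integral_satInd T γ, fun m σ => successProb_eq_expectation T γ β σ,
      fun P hP => ⟨avgSuccessProb_eq_sum_reducedConfigs β hP, fun r hr =>
        ⟨integrable_avgSuccessProb_poissonMeasure β hP _,
          poissonAvgSuccessProb_eq_sum_reducedConfigs β hP hr⟩⟩⟩
  · refine ⟨sumProgram (.op (.power 18 18 1)), 349, ?_⟩
    intro k n hn T γ β _ P hP m final hfinal
    have : NeZero n := ⟨by omega⟩
    -- The missing second scalar input defaults to `0`, hence `r := 0`. The constant `349` adds `8`
    -- for the powers to `341`.
    obtain ⟨h0, he, hp, ho⟩ := sumProgram_run (r := 0) hn (appliesTo_power m _) rfl rfl rfl rfl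
      hfinal
    refine ⟨h0.trans (avgSuccessProb_eq_sum_reducedConfigs β hP m).symm, ?_, ?_⟩
    · exact he.trans (by omega)
    · omega
  · refine ⟨sumProgram (Program.chain (.op (.minus 18 18 4))
      [.op (.times 18 14 18), .op (.expo 18 18)]), 365, ?_⟩
    intro k n hn T γ β _ P hP r hr final hfinal
    have : NeZero n := ⟨by omega⟩
    -- The missing second counter defaults to `0`. Three operations per term to form the exponential
    -- give `365 = 8 * 3 + 341`.
    obtain ⟨h0, he, hp, ho⟩ := sumProgram_run (r := r) hn (appliesTo_exp 0 _) rfl rfl rfl rfl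
      hfinal
    refine ⟨h0.trans (poissonAvgSuccessProb_eq_sum_reducedConfigs β hP hr).symm, ?_, ?_, ?_⟩
    · exact he.trans (by omega)
    · omega
    · omega
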